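/- **Definitions.** All graphs are finite, simple and undirected. A *colored graph* is a graph $H$ together with a (not necessarily proper) map from $V(H)$ to a set of colors; the *color class* of $i$ is the set of vertices of color $i$. A *tree decomposition* of $G$ is a pair $(T,\beta)$ of a finite tree $T$ and a map $\beta:V(T)\to 2^{V(G)}$ such that for every $v\in V(G)$ the set $\{t: v\in\beta(t)\}$ is nonempty and connected in $T$, and every edge of $G$ is contained in some bag $\beta(t)$. Its width is $\max_t|\beta(t)|-1$, and the treewidth of $G$ is the minimum width of a tree decomposition of $G$. If $T$ is rooted, put $\sigma(t)=\emptyset$ for the root $t$ and $\sigma(t)=\beta(t)\cap\beta(s)$ if $s$ is the parent of $t$. For a colored graph $H$: - $\mathrm{spasm}(H)$ is the set of all colored graphs $F$ (without loops) that are images of $H$ under a color-preserving homomorphism that is surjective on vertices and on edges; equivalently, up to isomorphism, the quotients of $H$ by partitions of $V(H)$ into monochromatic independent sets. - $\widehat H$ is the simple graph with one vertex for each nonempty color class of $H$, in which two distinct classes are adjacent if $H$ has an edge between them. - $H^{\bullet}$ is obtained from $H$ by making each color class a clique, and $H^{\bullet\setminus i}$ is obtained from $H$ by making each color class except class $i$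 a clique. - A *$c$-flower centered at color class $i$ in $H$* is a collection of $c$ pairwise vertex-disjoint paths of length at least $1$ in $H^{\bullet\setminus i}$, each having both endpoints in class $i$. - A *guarded cutvertex decomposition* of $H$ is a triple $(T,\beta,g)$, where $(T,\beta)$ is a tree decomposition of $H^{\bullet}$ with $T$ rooted and $g:V(T)\to 2^{V(H)}$ satisfies $\sigma(t)\subseteq g(t)\subseteq\beta(t)$ for all $t$, such that (i) for every $t$, $g(t)$ is a vertex cover of $H[\beta(t)]$, and (ii) for every $t$ and every child $t'$ of $t$, $|\sigma(t')\setminus g(t)|\le 1$. Its *guard size* is $\max_t|g(t)|$; its *bags have at most $c$ colors* if every $\beta(t)$ contains vertices of at most $c$ different colors. **Theorem.** Let $\mathcal H$ be a class of colored graphs. The following statements are equivalent: 1. There is a constant $c$ such that for every $H\in\mathcal H$, every graph in $\mathrm{spasm}(H)$ has treewidth at most $c$. 2. There is a constant $c$ such that for every $H\in\mathcal H$, $\widehat H$ has treewidth at most $c$ and there is no $c$-flower centered at any color class of $H$. 3. There is a constant $c$ such that for every $H\in\mathcal H$, there is a guarded cutvertex decomposition of $H$ with guard size at most $c$ whose bags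 have at most $c$ colors. -/

import Mathlib

universe u v

/-- A tree decomposition `(T, β)` of `G`: `T` is a finite tree, the nodes whose bag contains a given
vertex form a nonempty connected subset of `T`, and every edge lies in some bag. -/
structure TreeDecomposition {V : Type u} (G : SimpleGraph V) where
  Node : Type
  finite_node : Finite Node
  tree : SimpleGraph Node
  isTree : tree.IsTree
  bag : Node → Set V
  bag_connected : ∀ x : V, (tree.induce {t | x ∈ bag t}).Connected
  bag_edge : ∀ x y : V, G.Adj x y → ∃ t, x ∈ bag t ∧ y ∈ bag t

/-- `G` has treewidth at most `k`: some tree decomposition has all bags of size at most `k + 1`. -/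
def TreewidthAtMost {V : Type u} (G : SimpleGraph V) (k : ℕ) : Prop :=
  ∃ D : TreeDecomposition G, ∀ t, (D.bag t).encard ≤ k + 1

/-- In the tree `T` directed away from the root `r`, the node `t'` is a child of `t`. -/
def IsChild {N : Type u} (T : SimpleGraph N) (r t t' : N) : Prop :=
  T.Adj t t' ∧ T.dist r t' = T.dist r t + 1

/-- The separator `σ(t)`: the intersection of the bags of `t` and of its parent; it is empty when
`t` is the root, which has no parent. -/
def TreeDecomposition.separator {V : Type u} {G : SimpleGraph V} (D : TreeDecomposition G)
    (r t : D.Node) : Set V :=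
  {x | ∃ s, IsChild D.tree r s t ∧ x ∈ D.bag t ∧ x ∈ D.bag s}

/-- A finite simple graph whose vertices are colored (not necessarily properly) from the palette
`C`. As there are finitely many vertices, only finitely many colors are used. -/
structure ColoredGraph (C : Type v) where
  V : Type u
  finite_V : Finite V
  graph : SimpleGraph V
  color : V → C

namespace ColoredGraph

variable {C : Type v}

/-- The spasm of `H`: the colored graphs `F` that are images of `H` under a color-preserving
homomorphism hitting all vertices and all edges of `F`. Since `F` has no loops, these are, up to
isomorphism, the quotients of `H` by partitions into monochromatic independent sets. -/
def spasm (H : ColoredGraph.{u, v} C) : Set (ColoredGraph.{u, v} C) :=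
  {F | ∃ f : H.graph →g F.graph,
    Function.Surjective f ∧
    (∀ a b, F.graph.Adj a b → ∃ x y, H.graph.Adj x y ∧ f x = a ∧ f y = b) ∧
    ∀ x, F.color (f x) = H.color x}

/-- The graph `Ĥ`: one vertex for each (nonempty) color class; distinct classes are adjacent if
there is an edge of `H` between them. -/
def contraction (H : ColoredGraph.{u, v} C) : SimpleGraph (Set.range H.color) where
  Adj i j := i ≠ j ∧ ∃ x y, H.graph.Adj x y ∧ H.color x = i ∧ H.color y = j
  symm := ⟨fun _ _ ⟨hne, x, y, h, hx, hy⟩ => ⟨hne.symm, y, x, h.symm, hy, hx⟩⟩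
  loopless := ⟨fun _ h => h.1 rfl⟩

/-- The supergraph of `H` in which each color class is made a clique. -/
def cliqueGraph (H : ColoredGraph.{u, v} C) : SimpleGraph H.V where
  Adj x y := x ≠ y ∧ (H.graph.Adj x y ∨ H.color x = H.color y)
  symm := ⟨fun _ _ ⟨hne, h⟩ => ⟨hne.symm, h.imp (fun h => h.symm) Eq.symm⟩⟩
  loopless := ⟨fun _ h => h.1 rfl⟩

/-- The supergraph of `H` in which each color class except class `i` is made a clique. -/
def cliqueGraphExcept (H : ColoredGraph.{u, v} C) (i : C) : SimpleGraph H.V where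
  Adj x y := x ≠ y ∧ (H.graph.Adj x y ∨ (H.color x = H.color y ∧ H.color x ≠ i))
  symm := ⟨fun _ _ ⟨hne, h⟩ =>
    ⟨hne.symm, h.imp (fun h => h.symm) fun ⟨h, hi⟩ => ⟨h.symm, h ▸ hi⟩⟩⟩
  loopless := ⟨fun _ h => h.1 rfl⟩

/-- There is a `c`-flower centered at color class `i`: `c` pairwise vertex-disjoint paths of length
at least one in `H.cliqueGraphExcept i`, each with both endpoints in class `i`. -/
def HasFlower (H : ColoredGraph.{u, v} C) (c : ℕ) (i : C) : Prop :=
  ∃ (a b : Fin c → H.V) (p : ∀ j, (H.cliqueGraphExcept i).Walk (a j) (b j)),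
    (∀ j, (p j).IsPath ∧ 1 ≤ (p j).length ∧ H.color (a j) = i ∧ H.color (b j) = i) ∧
    ∀ j k, j ≠ k → List.Disjoint (p j).support (p k).support

/-- A guarded cutvertex decomposition `(T, β, g)` of `H`, with `T` rooted at `root`. The tree
decomposition is one of `H.cliqueGraph`, whereas the guards cover only the edges of `H`. -/
structure GuardedCutvertexDecomposition (H : ColoredGraph.{u, v} C) extends
    TreeDecomposition H.cliqueGraph where
  root : Node
  guard : Node → Set H.V
  separator_subset_guard : ∀ t, toTreeDecomposition.separator root t ⊆ guard t
  guard_subset_bag : ∀ t, guard t ⊆ bag t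
  guard_isVertexCover : ∀ t,
    (H.graph.induce (bag t)).IsVertexCover {x : bag t | (x : H.V) ∈ guard t}
  separator_diff_guard : ∀ t t', IsChild tree root t t' →
    (toTreeDecomposition.separator root t' \ guard t).encard ≤ 1

/-- The guard size is at most `c`. -/
def GuardedCutvertexDecomposition.GuardSizeAtMost {H : ColoredGraph.{u, v} C}
    (D : H.GuardedCutvertexDecomposition) (c : ℕ) : Prop :=
  ∀ t, (D.guard t).encard ≤ c

/-- The bags have at most `c` colors. -/
def GuardedCutvertexDecomposition.BagColorsAtMost {H : ColoredGraph.{u, v} C}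
    (D : H.GuardedCutvertexDecomposition) (c : ℕ) : Prop :=
  ∀ t, (H.color '' D.bag t).encard ≤ c

end ColoredGraph

-- The implications are proved in the cycle 3 → 1 → 2 → 3.
--
-- From 3 to 1 (`treewidthAtMost_of_guarded`): fibres of a spasm map are monochromatic, so they are
-- cliques of `cliqueGraph` and each occupies a subtree of the given decomposition. Every node is
-- expanded into a star whose center holds the images of the guards and whose leaves each add at
-- most one more image vertex. Since guards are vertex covers, every edge of the image fits into a
-- leaf. Since at most one vertex of a separator is unguarded at the parent, a child can be hung on
-- a single leaf. The width is then at most the guard size.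
--
-- From 1 to 2: merging nonadjacent vertices of equal color as long as possible makes all color
-- classes cliques, and contracting these cliques gives `contraction`
-- (`treewidthAtMost_contraction`). For flowers, merging makes the petals use genuine edges only
-- (`exists_spasm_hasPacking`). Bounded treewidth gives a proper coloring with few colors, so many
-- petals have independent first ends and independent second ends. Arranged in a `k × k` array, with
-- first ends identified along rows and second ends along columns, they form a clique minor on `k`
-- branch sets (`le_of_grid`).
--
-- From 2 to 3: by the Erdős–Pósa property of `A`-paths, derived from Menger's theorem, a bounded
-- set hits all paths of `cliqueGraphExcept i` between two vertices of color `i`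
-- (`exists_hitting_of_not_hasPacking`). It can be moved to colors sharing a bag with `i` in a tree
-- decomposition of `contraction` (`exists_near_hitting`). Each node of that decomposition then
-- receives the vertices of its colors and of their hitting sets, and is split according to the
-- components of the part of the graph below it. Guards are the hitting sets, the `special` vertices
-- and the attachments to the part above. Two unguarded vertices attached to one component would be
-- joined through it outside a hitting set. This is impossible for equal colors, and for different
-- colors it makes them special (`boundary_unique`).

universe w

/-! ### Reachability inside a vertex set. -/

section Reachability

variable {V : Type*}

/-- `y` can be reached from `x` in `G` by a walk all of whose vertices lie in `S`. -/
inductive ReachIn (G : SimpleGraph V) (S : Set V) (x : V) : V → Prop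
  | refl : x ∈ S → ReachIn G S x x
  | tail {y z : V} : ReachIn G S x y → G.Adj y z → z ∈ S → ReachIn G S x z

namespace ReachIn

variable {G G' : SimpleGraph V} {S S' : Set V} {x y z : V}

theorem left_mem (h : ReachIn G S x y) : x ∈ S := by
  induction h with
  | refl h => exact h
  | tail _ _ _ ih => exact ih

theorem right_mem (h : ReachIn G S x y) : y ∈ S := by
  cases h with
  | refl h => exact h
  | tail _ _ h => exact h

theorem trans (h : ReachIn G S x y) (h' : ReachIn G S y z) : ReachIn G S x z := by
  induction h' with
  | refl _ => exact h
  | tail _ hadj hz ih => exact ih.tail hadj hz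

theorem head (hx : x ∈ S) (hadj : G.Adj x y) (h : ReachIn G S y z) : ReachIn G S x z :=
  ((refl hx).tail hadj h.left_mem).trans h

theorem symm (h : ReachIn G S x y) : ReachIn G S y x := by
  induction h with
  | refl h => exact refl h
  | tail _ hadj hz ih => exact head hz hadj.symm ih

theorem mono (h : ReachIn G S x y) (hG : G ≤ G') (hS : S ⊆ S') : ReachIn G' S' x y := by
  induction h with
  | refl h => exact refl (hS h)
  | tail _ hadj hz ih => exact ih.tail (hG hadj) (hS hz)

theorem mono_set (h : ReachIn G S x y) (hS : S ⊆ S') : ReachIn G S' x y := h.mono le_rfl hS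

theorem inside_component (h : ReachIn G S x y) : ReachIn G {w | ReachIn G S x w} x y := by
  induction h with
  | refl h => exact refl (ReachIn.refl h)
  | tail h hadj hz ih => exact ih.tail hadj (h.tail hadj hz)

/-- Walks can be mapped along maps that preserve or contract edges. -/
theorem map {W : Type*} {K : SimpleGraph W} {R : Set W} (f : V → W)
    (hf : ∀ a ∈ S, ∀ b ∈ S, G.Adj a b → f a = f b ∨ K.Adj (f a) (f b)) (hS : ∀ a ∈ S, f a ∈ R)
    (h : ReachIn G S x y) : ReachIn K R (f x) (f y) := by
  induction h with
  | refl h => exact refl (hS _ h)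
  | tail h hadj hz ih =>
    rcases hf _ h.right_mem _ hz hadj with he | he
    · rwa [← he]
    · exact ih.tail he (hS _ hz)

theorem exists_walk (h : ReachIn G S x y) : ∃ p : G.Walk x y, ∀ v ∈ p.support, v ∈ S := by
  induction h with
  | refl h => exact ⟨.nil, by simpa using h⟩
  | tail h hadj hz ih =>
    obtain ⟨p, hp⟩ := ih
    refine ⟨p.concat hadj, fun v hv => ?_⟩
    rw [SimpleGraph.Walk.support_concat] at hv
    simp only [List.mem_append, List.mem_singleton] at hv
    rcases hv with hv | rfl
    · exact hp v hv
    · exact hz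

theorem exists_path (h : ReachIn G S x y) :
    ∃ p : G.Walk x y, p.IsPath ∧ ∀ v ∈ p.support, v ∈ S := by
  classical
  obtain ⟨p, hp⟩ := h.exists_walk
  exact ⟨p.bypass, p.bypass_isPath, fun v hv => hp v (p.support_bypass_subset_support hv)⟩

theorem of_walk (p : G.Walk x y) (hp : ∀ v ∈ p.support, v ∈ S) : ReachIn G S x y := by
  induction p with
  | nil => exact refl (hp _ (by simp))
  | cons hadj p ih =>
    exact head (hp _ (by simp)) hadj (ih fun v hv => hp v (by simp [hv]))

theorem of_connected (h : (G.induce S).Connected) (hx : x ∈ S) (hy : y ∈ S) :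
    ReachIn G S x y := by
  obtain ⟨p⟩ := h.preconnected ⟨x, hx⟩ ⟨y, hy⟩
  have key : ∀ {a b : S}, (G.induce S).Walk a b → ReachIn G S a b := by
    intro a b p
    induction p with
    | nil => exact refl (Subtype.mem _)
    | cons hadj _ ih => exact head (Subtype.mem _) hadj ih
  exact key p

theorem reachable_induce (h : ReachIn G S x y) :
    (G.induce S).Reachable ⟨x, h.left_mem⟩ ⟨y, h.right_mem⟩ := by
  induction h with
  | refl h => exact .refl _
  | tail h hadj hz ih =>
    refine ih.trans (SimpleGraph.Adj.reachable ?_)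
    exact hadj

theorem connected_of (hS : x ∈ S) (h : ∀ y ∈ S, ReachIn G S x y) : (G.induce S).Connected := by
  have : Nonempty S := ⟨⟨x, hS⟩⟩
  refine ⟨fun a b => ?_⟩
  exact ((h a a.2).reachable_induce.symm).trans (h b b.2).reachable_induce

/-- Following a walk until it first meets `B`. -/
theorem first_hit {B : Set V} (h : ReachIn G S x y) (hy : y ∈ B) :
    ∃ b ∈ B, ∃ D ⊆ S, ReachIn G D x b ∧ (∀ v ∈ D, v ∈ B → v = b) ∧
      ∀ v ∈ D, v ≠ b → ReachIn G (D \ B) x v := by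
  -- Either `B` has been met already, or everything so far happened outside `B`. At the first
  -- meeting, `D` is the component of `x` outside `B` together with the vertex hit.
  have key : ∀ {z}, ReachIn G S x z → (∃ b ∈ B, ∃ D ⊆ S, ReachIn G D x b ∧
      (∀ v ∈ D, v ∈ B → v = b) ∧ ∀ v ∈ D, v ≠ b → ReachIn G (D \ B) x v) ∨
      ReachIn G (S \ B) x z := by
    intro z hz
    induction hz with
    | refl hx =>
      by_cases hB : x ∈ B
      · refine Or.inl ⟨x, hB, {x}, by simpa using hx, refl rfl, by simp, ?_⟩
        intro v hv hne
        exact absurd hv hne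
      · exact Or.inr (refl ⟨hx, hB⟩)
    | @tail y z h hadj hz ih =>
      rcases ih with ih | ih
      · exact Or.inl ih
      by_cases hB : z ∈ B
      · refine Or.inl ⟨z, hB, insert z {w | ReachIn G (S \ B) x w}, ?_, ?_, ?_, ?_⟩
        · rintro w (rfl | hw)
          · exact hz
          · exact hw.right_mem.1
        · exact (ih.inside_component.mono_set (Set.subset_insert _ _)).tail hadj (Or.inl rfl)
        · rintro v (rfl | hv) hvB
          · rfl
          · exact absurd hvB hv.right_mem.2
        · rintro v (rfl | hv) hne
          · exact absurd rfl hne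
          · refine hv.inside_component.mono_set fun w hw => ⟨Or.inr hw, ?_⟩
            exact (ReachIn.right_mem hw).2
      · exact Or.inr (ih.tail hadj ⟨hz, hB⟩)
  rcases key h with h | h
  · exact h
  · exact absurd hy h.right_mem.2

end ReachIn

end Reachability

/-! ### Menger's theorem. -/

section Menger

variable {V : Type*}

/-- There are `k` pairwise disjoint connections in `G` from `A` to `B`. -/
def HasLinkage (G : SimpleGraph V) (A B : Set V) (k : ℕ) : Prop :=
  ∃ (a b : Fin k → V) (D : Fin k → Set V),
    (∀ j, a j ∈ A ∧ b j ∈ B ∧ ReachIn G (D j) (a j) (b j)) ∧ Pairwise (Function.onFun Disjoint D)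

/-- `S` meets every walk of `G` from `A` to `B`. -/
def Separates (G : SimpleGraph V) (A B S : Set V) : Prop :=
  ∀ a ∈ A, ∀ b ∈ B, ¬ ReachIn G Sᶜ a b

variable {G G' : SimpleGraph V} {A B S : Set V} {k : ℕ}

theorem Separates.symm (h : Separates G A B S) : Separates G B A S :=
  fun b hb a ha hr => h a ha b hb hr.symm

theorem HasLinkage.mono (h : HasLinkage G A B k) (hG : G ≤ G') : HasLinkage G' A B k := by
  obtain ⟨a, b, D, h, hD⟩ := h
  exact ⟨a, b, D, fun j => ⟨(h j).1, (h j).2.1, (h j).2.2.mono hG subset_rfl⟩, hD⟩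

theorem HasLinkage.first_hit (h : HasLinkage G A B k) :
    ∃ (a b : Fin k → V) (D : Fin k → Set V),
      (∀ j, a j ∈ A ∧ b j ∈ B ∧ ReachIn G (D j) (a j) (b j) ∧ (∀ v ∈ D j, v ∈ B → v = b j) ∧
        ∀ v ∈ D j, v ≠ b j → ReachIn G (D j \ B) (a j) v) ∧
      Pairwise (Function.onFun Disjoint D) := by
  obtain ⟨a, b, D, h, hD⟩ := h
  choose b' hb' D' hD' h1 h2 h3 using fun j => (h j).2.2.first_hit (h j).2.1
  exact ⟨a, b', D', fun j => ⟨(h j).1, hb' j, h1 j, h2 j, h3 j⟩,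
    fun i j hij => (hD hij).mono (hD' i) (hD' j)⟩

theorem adj_deleteEdges_of_ne {x y u w : V} (h : G.Adj u w) (h1 : ¬ (u = x ∧ w = y))
    (h2 : ¬ (u = y ∧ w = x)) : (G.deleteEdges {s(x, y)}).Adj u w := by
  rw [SimpleGraph.deleteEdges_adj]
  refine ⟨h, ?_⟩
  simp only [Set.mem_singleton_iff, Sym2.eq_iff]
  tauto

/-- A walk of `G` from `A` that avoids `T` cannot use the edge `xy`: it never reaches `x`, because
`T` separates `A` from `x`, and it cannot reach `y` first, because `S` keeps `A` away from `y`. So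
it stays in the graph without `xy` and avoids `S`, hence does not reach `B`. -/
theorem separates_of_separates_deleteEdges {x y : V} {T : Set V}
    (hS : Separates (G.deleteEdges {s(x, y)}) A B S)
    (hy : ∀ a ∈ A, ¬ ReachIn (G.deleteEdges {s(x, y)}) Sᶜ a y)
    (hT : Separates (G.deleteEdges {s(x, y)}) A (insert x S) T) : Separates G A B T := by
  intro a ha b hb hr
  have key : ∀ {v}, ReachIn G Tᶜ a v → ReachIn (G.deleteEdges {s(x, y)}) (Tᶜ \ S) a v := by
    intro v hv
    induction hv with
    | refl h =>
      refine .refl ⟨h, fun haS => hT a ha a (Or.inr haS) (.refl h)⟩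
    | @tail v z h hadj hz ih =>
      have hadj' : (G.deleteEdges {s(x, y)}).Adj v z := by
        refine adj_deleteEdges_of_ne hadj ?_ ?_
        · rintro ⟨rfl, -⟩
          exact hT a ha _ (Or.inl rfl) (ih.mono_set Set.sdiff_subset)
        · rintro ⟨rfl, -⟩
          exact hy a ha (ih.mono_set fun w hw => hw.2)
      refine ih.tail hadj' ⟨hz, fun hzS => ?_⟩
      exact hT a ha z (Or.inr hzS) ((ih.mono_set Set.sdiff_subset).tail hadj' hz)
  exact hS a ha b hb ((key hr).mono_set fun w hw => hw.2)

theorem separates_insert_of_deleteEdges {x y : V}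
    (hS : Separates (G.deleteEdges {s(x, y)}) A B S) : Separates G A B (insert x S) := by
  intro a ha b hb hr
  refine hS a ha b hb ?_
  have key : ∀ {v}, ReachIn G (insert x S)ᶜ a v → ReachIn (G.deleteEdges {s(x, y)}) Sᶜ a v := by
    intro v hv
    induction hv with
    | refl h => exact .refl fun h' => h (Or.inr h')
    | @tail v z h hadj hz ih =>
      refine ih.tail (adj_deleteEdges_of_ne hadj ?_ ?_) fun h' => hz (Or.inr h')
      · rintro ⟨rfl, -⟩
        exact h.right_mem (Or.inl rfl)
      · rintro ⟨-, rfl⟩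
        exact hz (Or.inl rfl)
  exact key hr

theorem reachIn_deleteEdges_or {x y a b : V} (hr : ReachIn G S a b) :
    ReachIn (G.deleteEdges {s(x, y)}) S a b ∨ ReachIn (G.deleteEdges {s(x, y)}) S a x ∨
      ReachIn (G.deleteEdges {s(x, y)}) S a y := by
  induction hr with
  | refl h => exact Or.inl (.refl h)
  | @tail v z h hadj hz ih =>
    rcases ih with ih | ih
    · by_cases h1 : v = x
      · exact Or.inr (Or.inl (h1 ▸ ih))
      by_cases h2 : v = y
      · exact Or.inr (Or.inr (h2 ▸ ih))
      exact Or.inl (ih.tail (adj_deleteEdges_of_ne hadj (by tauto) (by tauto)) hz)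
    · exact Or.inr ih

theorem surj_of_injective_ncard {P : Set V} [Finite V] (hP : P.ncard = k) (p : Fin k → V)
    (hp : ∀ j, p j ∈ P) (hinj : Function.Injective p) {v : V} (hv : v ∈ P) : ∃ j, p j = v := by
  have h1 : Set.range p ⊆ P := by
    rintro _ ⟨j, rfl⟩
    exact hp j
  have h2 : (Set.range p).ncard = k := by
    rw [← Set.image_univ, Set.ncard_image_of_injective _ hinj, Set.ncard_univ, Nat.card_fin]
  have h3 := Set.eq_of_subset_of_ncard_le h1 (by omega) (Set.toFinite _)
  rw [← h3] at hv
  exact hv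

/-- The gluing step of Göring's proof of Menger's theorem. -/
theorem hasLinkage_glue [Finite V] {x y : V} (hxy : G.Adj x y)
    (hS : Separates (G.deleteEdges {s(x, y)}) A B S) (hcard : S.ncard < k)
    (hk : ∀ T, Separates G A B T → k ≤ T.ncard)
    (hx : ∃ a ∈ A, ReachIn (G.deleteEdges {s(x, y)}) Sᶜ a x)
    (hy : ∃ b ∈ B, ReachIn (G.deleteEdges {s(x, y)}) Sᶜ b y)
    (ih : ∀ A' B' : Set V,
      (∀ T, Separates (G.deleteEdges {s(x, y)}) A' B' T → k ≤ T.ncard) →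
        HasLinkage (G.deleteEdges {s(x, y)}) A' B' k) : HasLinkage G A B k := by
  have hsym : s(y, x) = s(x, y) := Sym2.eq_swap
  obtain ⟨a₀, ha₀, hx⟩ := hx
  obtain ⟨b₀, hb₀, hy⟩ := hy
  have hAy : ∀ a ∈ A, ¬ ReachIn (G.deleteEdges {s(x, y)}) Sᶜ a y :=
    fun a ha h => hS a ha b₀ hb₀ (h.trans hy.symm)
  have hBx : ∀ b ∈ B, ¬ ReachIn (G.deleteEdges {s(x, y)}) Sᶜ b x :=
    fun b hb h => hS a₀ ha₀ b hb (hx.trans h.symm)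
  have hxS : x ∉ S := hx.right_mem
  have hyS : y ∉ S := hy.right_mem
  have hP : (insert x S).ncard = k := by
    have h1 := hk _ (separates_insert_of_deleteEdges hS)
    have h2 := Set.ncard_insert_of_notMem hxS (Set.toFinite S)
    omega
  have hQ : (insert y S).ncard = k := by
    have h2 := Set.ncard_insert_of_notMem hxS (Set.toFinite S)
    have h3 := Set.ncard_insert_of_notMem hyS (Set.toFinite S)
    omega
  have L1 : HasLinkage (G.deleteEdges {s(x, y)}) A (insert x S) k :=
    ih _ _ fun T hT => hk T (separates_of_separates_deleteEdges hS hAy hT)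
  have L2 : HasLinkage (G.deleteEdges {s(x, y)}) B (insert y S) k := by
    refine ih _ _ fun T hT => hk T (Separates.symm ?_)
    refine separates_of_separates_deleteEdges (x := y) (y := x) (S := S) ?_ ?_ ?_
    · rw [hsym]; exact hS.symm
    · rw [hsym]; exact hBx
    · rw [hsym]; exact hT
  obtain ⟨a, p, D, hD, hDd⟩ := L1.first_hit
  obtain ⟨b, q, E, hE, hEd⟩ := L2.first_hit
  have inj_of : ∀ {f : Fin k → V} {F : Fin k → Set V}, (∀ j, f j ∈ F j) →
      Pairwise (Function.onFun Disjoint F) → Function.Injective f := by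
    intro f F hf hF i j hij
    by_contra hne
    exact Set.disjoint_left.1 (hF hne) (hf i) (hij ▸ hf j)
  have hp := inj_of (fun j => (hD j).2.2.1.right_mem) hDd
  have hq := inj_of (fun j => (hE j).2.2.1.right_mem) hEd
  -- As `S ∪ {x}` and `S ∪ {y}` have exactly `k` elements, the two linkages use all of them as ends.
  -- They are matched at equal vertices of `S`, and the end `x` with the end `y`.
  have hσ : ∀ j, ∃ j', (p j ∈ S ∧ q j' = p j) ∨ (p j = x ∧ q j' = y) := by
    intro j
    rcases (hD j).2.1 with h | h
    · obtain ⟨j', hj'⟩ := surj_of_injective_ncard hQ q (fun j => (hE j).2.1) hq (Or.inl rfl)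
      exact ⟨j', Or.inr ⟨h, hj'⟩⟩
    · obtain ⟨j', hj'⟩ := surj_of_injective_ncard hQ q (fun j => (hE j).2.1) hq (Or.inr h)
      exact ⟨j', Or.inl ⟨h, hj'⟩⟩
  choose σ hσ using hσ
  have hσinj : Function.Injective σ := by
    intro i j hij
    apply hp
    have hi := hσ i
    have hj := hσ j
    rw [hij] at hi
    rcases hi with ⟨h1, h2⟩ | ⟨h1, h2⟩ <;> rcases hj with ⟨h3, h4⟩ | ⟨h3, h4⟩
    · rw [← h2, ← h4]
    · exact absurd (by rw [← h2, h4] at h1; exact h1) hyS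
    · exact absurd (by rw [← h4, h2] at h3; exact h3) hyS
    · rw [h1, h3]
  -- A common vertex outside `S` would connect `A` to `B` without `xy` and avoiding `S`; a common
  -- vertex in `S` is the end of both connections, so they are matched.
  have hcross : ∀ i j, i ≠ j → Disjoint (D i) (E (σ j)) := by
    intro i j hij
    rw [Set.disjoint_left]
    intro w hwD hwE
    by_cases hwS : w ∈ S
    · have h1 := (hD i).2.2.2.1 w hwD (Or.inr hwS)
      have h2 := (hE (σ j)).2.2.2.1 w hwE (Or.inr hwS)
      have h3 : q (σ i) = p i := by
        rcases hσ i with h | h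
        · exact h.2
        · exact absurd (h1.trans h.1 ▸ hwS) hxS
      exact hij (hσinj (hq (h3.trans (h1.symm.trans h2))))
    · have h1 : ∃ a' ∈ A, ReachIn (G.deleteEdges {s(x, y)}) Sᶜ a' w := by
        by_cases hw : w = p i
        · rcases (hD i).2.1 with h | h
          · exact ⟨a₀, ha₀, by rw [hw, h]; exact hx⟩
          · exact absurd (hw ▸ h) hwS
        · exact ⟨a i, (hD i).1, ((hD i).2.2.2.2 w hwD hw).mono_set fun v hv h => hv.2 (Or.inr h)⟩
      have h2 : ∃ b' ∈ B, ReachIn (G.deleteEdges {s(x, y)}) Sᶜ b' w := by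
        by_cases hw : w = q (σ j)
        · rcases (hE (σ j)).2.1 with h | h
          · exact ⟨b₀, hb₀, by rw [hw, h]; exact hy⟩
          · exact absurd (hw ▸ h) hwS
        · exact ⟨b (σ j), (hE (σ j)).1,
            ((hE (σ j)).2.2.2.2 w hwE hw).mono_set fun v hv h => hv.2 (Or.inr h)⟩
      obtain ⟨a', ha', h1⟩ := h1
      obtain ⟨b', hb', h2⟩ := h2
      exact hS a' ha' b' hb' (h1.trans h2.symm)
  refine ⟨a, b ∘ σ, fun j => D j ∪ E (σ j), fun j => ⟨(hD j).1, (hE (σ j)).1, ?_⟩, ?_⟩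
  · have hle := SimpleGraph.deleteEdges_le (G := G) {s(x, y)}
    have h1 := (hD j).2.2.1.mono hle (Set.subset_union_left (t := E (σ j)))
    have h2 := (hE (σ j)).2.2.1.symm.mono hle (Set.subset_union_right (s := D j))
    rcases hσ j with h | h
    · exact h1.trans (h.2 ▸ h2)
    · rw [h.1] at h1
      rw [h.2] at h2
      exact (h1.tail hxy h2.left_mem).trans h2
  · intro i j hij
    simp only [Function.onFun, Set.disjoint_union_left, Set.disjoint_union_right]
    exact ⟨⟨hDd hij, (hcross j i hij.symm).symm⟩, hcross i j hij, hEd (hσinj.ne hij)⟩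

/-- **Menger's theorem**: if every set separating `A` from `B` has at least `k` vertices, then there
are `k` disjoint connections from `A` to `B`. -/
theorem hasLinkage_of_separates [Finite V] (G : SimpleGraph V) (A B : Set V) (k : ℕ)
    (hk : ∀ T, Separates G A B T → k ≤ T.ncard) : HasLinkage G A B k := by
  induction hn : G.edgeSet.ncard using Nat.strong_induction_on generalizing G A B with
  | _ n ih =>
    subst hn
    by_cases hE : ∃ x y, G.Adj x y
    · obtain ⟨x, y, hxy⟩ := hE
      have ih' : ∀ A' B' : Set V,
          (∀ T, Separates (G.deleteEdges {s(x, y)}) A' B' T → k ≤ T.ncard) →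
            HasLinkage (G.deleteEdges {s(x, y)}) A' B' k := by
        intro A' B' h
        refine ih _ ?_ _ _ _ h rfl
        rw [SimpleGraph.edgeSet_deleteEdges]
        refine Set.ncard_lt_ncard ?_ (Set.toFinite _)
        refine ⟨Set.sdiff_subset, fun h => ?_⟩
        exact (h (G.mem_edgeSet.2 hxy)).2 rfl
      by_cases hS : ∃ S, Separates (G.deleteEdges {s(x, y)}) A B S ∧ S.ncard < k
      · obtain ⟨S, hS, hcard⟩ := hS
        -- `S` is too small to separate in `G`, so some walk avoiding `S` uses `xy`. Its two ends
        -- reach different ends of this edge, which is the situation of `hasLinkage_glue`.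
        have hn : ¬ Separates G A B S := fun h => by
          have := hk S h
          omega
        simp only [Separates] at hn
        push Not at hn
        obtain ⟨a, ha, b, hb, hab⟩ := hn
        have h1 := (reachIn_deleteEdges_or (x := x) (y := y) hab).resolve_left (hS a ha b hb)
        have h2 := (reachIn_deleteEdges_or (x := x) (y := y) hab.symm).resolve_left
          fun h => hS a ha b hb h.symm
        rcases h1 with h1 | h1 <;> rcases h2 with h2 | h2
        · exact absurd (h1.trans h2.symm) (hS a ha b hb)
        · exact hasLinkage_glue hxy hS hcard hk ⟨a, ha, h1⟩ ⟨b, hb, h2⟩ ih'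
        · have hsym : s(y, x) = s(x, y) := Sym2.eq_swap
          refine hasLinkage_glue (x := y) (y := x) (S := S) hxy.symm ?_ hcard hk ⟨a, ha, ?_⟩
            ⟨b, hb, ?_⟩ ?_
          all_goals rw [hsym]; assumption
        · exact absurd (h1.trans h2.symm) (hS a ha b hb)
      · push Not at hS
        exact (ih' A B hS).mono (SimpleGraph.deleteEdges_le _)
    · have hsep : Separates G A B (A ∩ B) := by
        intro a ha b hb hr
        cases hr with
        | refl h => exact h ⟨ha, hb⟩
        | tail _ hadj _ => exact hE ⟨_, _, hadj⟩
      have hcard := hk _ hsep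
      have hfin : Fintype (A ∩ B : Set V) := Fintype.ofFinite _
      have : Nonempty (Fin k ↪ (A ∩ B : Set V)) := by
        refine Function.Embedding.nonempty_of_card_le ?_
        rw [Fintype.card_fin, ← Nat.card_eq_fintype_card, Nat.card_coe_set_eq]
        exact hcard
      obtain ⟨f⟩ := this
      refine ⟨fun j => f j, fun j => f j, fun j => {(f j : V)},
        fun j => ⟨(f j).2.1, (f j).2.2, .refl rfl⟩, fun i j hij => ?_⟩
      simp only [Function.onFun, Set.disjoint_singleton]
      exact fun h => hij (f.injective (Subtype.ext h))

end Menger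

/-! ### The Erdős–Pósa property of paths with both ends in a set. -/

section Packing

variable {V : Type*}

/-- `G` has `n` disjoint connected sets, each containing two distinct vertices of `A`. -/
def HasPacking (G : SimpleGraph V) (A : Set V) (n : ℕ) : Prop :=
  ∃ (a b : Fin n → V) (D : Fin n → Set V),
    (∀ j, a j ∈ A ∧ b j ∈ A ∧ a j ≠ b j ∧ ReachIn G (D j) (a j) (b j)) ∧
      Pairwise (Function.onFun Disjoint D)

variable {G : SimpleGraph V} {A S : Set V} {m n : ℕ}

theorem HasPacking.of_family {ι : Type*} [Fintype ι] (hn : n ≤ Fintype.card ι) (a b : ι → V)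
    (D : ι → Set V) (h : ∀ j, a j ∈ A ∧ b j ∈ A ∧ a j ≠ b j ∧ ReachIn G (D j) (a j) (b j))
    (hD : Pairwise (Function.onFun Disjoint D)) : HasPacking G A n := by
  have : Nonempty (Fin n ↪ ι) := Function.Embedding.nonempty_of_card_le (by simpa using hn)
  obtain ⟨f⟩ := this
  exact ⟨a ∘ f, b ∘ f, D ∘ f, fun j => h (f j), fun i j hij => hD (f.injective.ne hij)⟩

theorem HasPacking.mono (h : HasPacking G A n) (hm : m ≤ n) : HasPacking G A m := by
  obtain ⟨a, b, D, h, hD⟩ := h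
  exact .of_family (by simpa using hm) a b D h hD

theorem HasPacking.exists_paths (h : HasPacking G A n) :
    ∃ (a b : Fin n → V) (p : ∀ j, G.Walk (a j) (b j)),
      (∀ j, a j ∈ A ∧ b j ∈ A ∧ a j ≠ b j ∧ (p j).IsPath) ∧
        ∀ i j, i ≠ j → List.Disjoint (p i).support (p j).support := by
  obtain ⟨a, b, D, h, hD⟩ := h
  choose p hp hpD using fun j => (h j).2.2.2.exists_path
  refine ⟨a, b, p, fun j => ⟨(h j).1, (h j).2.1, (h j).2.2.1, hp j⟩, fun i j hij v hi hj => ?_⟩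
  exact Set.disjoint_left.1 (hD hij) (hpD i v hi) (hpD j v hj)

theorem reachIn_getVert {x y : V} (p : G.Walk x y) {i j : ℕ} (hij : i ≤ j) (hj : j ≤ p.length) :
    ReachIn G {w | ∃ l, i ≤ l ∧ l ≤ j ∧ p.getVert l = w} (p.getVert i) (p.getVert j) := by
  induction j, hij using Nat.le_induction with
  | base => exact .refl ⟨i, le_rfl, le_rfl, rfl⟩
  | succ j hij ih =>
    refine ((ih (by omega)).mono_set ?_).tail (p.adj_getVert_succ (by omega))
      ⟨j + 1, by omega, le_rfl, rfl⟩
    rintro w ⟨l, h1, h2, rfl⟩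
    exact ⟨l, h1, by omega, rfl⟩

/-- Many disjoint connections from `A` to a single path can be paired up along the path. -/
theorem hasPacking_of_landing {x y : V} (p : G.Walk x y) (hp : p.IsPath) {N : ℕ}
    (a s : Fin N → V) (D : Fin N → Set V)
    (h : ∀ j, a j ∈ A ∧ s j ∈ p.support ∧ ReachIn G (D j) (a j) (s j) ∧
      ∀ v ∈ D j, v ∈ p.support → v = s j)
    (hD : Pairwise (Function.onFun Disjoint D)) (hN : 2 * m ≤ N) : HasPacking G A m := by
  have hs : Function.Injective s := by
    intro i j hij
    by_contra hne
    exact Set.disjoint_left.1 (hD hne) (h i).2.2.1.right_mem (hij ▸ (h j).2.2.1.right_mem)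
  choose pos hpos hlen using fun j => SimpleGraph.Walk.mem_support_iff_exists_getVert.1 (h j).2.1
  have hposinj : Function.Injective pos := by
    intro i j hij
    apply hs
    rw [← hpos i, ← hpos j, hij]
  -- The landing vertices are sorted by their position on `p`. The connections ranked `2 i` and `2 i
  -- + 1` are joined by the segment of `p` between them, and these segments are disjoint.
  set M : Finset ℕ := Finset.univ.image pos with hM
  have hcard : M.card = N := by
    rw [hM, Finset.card_image_of_injective _ hposinj, Finset.card_univ, Fintype.card_fin]
  set e := M.orderEmbOfFin hcard
  have he : ∀ r, ∃ j, pos j = e r := by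
    intro r
    obtain ⟨j, -, hj⟩ := Finset.mem_image.1 (M.orderEmbOfFin_mem hcard r)
    exact ⟨j, hj⟩
  choose κ hκ using he
  have hlt : ∀ r r', r < r' → pos (κ r) < pos (κ r') := by
    intro r r' hr
    rw [hκ, hκ]
    exact e.strictMono hr
  have hκinj : Function.Injective κ := by
    intro r r' hr
    apply e.injective
    rw [← hκ, ← hκ, hr]
  let lo : Fin m → Fin N := fun i => ⟨2 * i, by omega⟩
  let hi : Fin m → Fin N := fun i => ⟨2 * i + 1, by omega⟩
  have hlohi : ∀ i, lo i < hi i := fun i => by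
    simp only [lo, hi, Fin.mk_lt_mk]
    omega
  have hlow : ∀ i j : Fin m, i < j → hi i < lo j := fun i j hij => by
    simp only [lo, hi, Fin.mk_lt_mk]
    have : (i : ℕ) < j := hij
    omega
  let seg : Fin m → Set V :=
    fun i => {w | ∃ l, pos (κ (lo i)) ≤ l ∧ l ≤ pos (κ (hi i)) ∧ p.getVert l = w}
  have hseg : ∀ i, ReachIn G (seg i) (s (κ (lo i))) (s (κ (hi i))) := by
    intro i
    have := reachIn_getVert p (hlt _ _ (hlohi i)).le (hlen (κ (hi i)))
    rwa [hpos, hpos] at this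
  have hsegsub : ∀ i, ∀ w ∈ seg i, w ∈ p.support := by
    rintro i _ ⟨l, -, -, rfl⟩
    exact p.getVert_mem_support l
  have hsegland : ∀ i r, r ≠ lo i → r ≠ hi i → s (κ r) ∉ seg i := by
    rintro i r h1 h2 ⟨l, hl1, hl2, hl3⟩
    rw [← hpos] at hl3
    have hl4 := hp.getVert_injOn (hl2.trans (hlen _)) (hlen _) hl3
    subst hl4
    have h3 : lo i ≤ r := not_lt.1 fun hr => absurd (hlt _ _ hr) (by omega)
    have h4 : r ≤ hi i := not_lt.1 fun hr => absurd (hlt _ _ hr) (by omega)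
    have h3' : 2 * (i : ℕ) ≤ r := h3
    have h4' : (r : ℕ) ≤ 2 * i + 1 := h4
    have h1' : (r : ℕ) ≠ 2 * i := fun h => h1 (Fin.ext h)
    have h2' : (r : ℕ) ≠ 2 * i + 1 := fun h => h2 (Fin.ext h)
    omega
  have hDseg : ∀ i r, r ≠ lo i → r ≠ hi i → Disjoint (D (κ r)) (seg i) := by
    intro i r h1 h2
    rw [Set.disjoint_left]
    intro w hw hw'
    have := (h (κ r)).2.2.2 w hw (hsegsub i w hw')
    exact hsegland i r h1 h2 (this ▸ hw')
  have hsegseg : ∀ i j, i < j → Disjoint (seg i) (seg j) := by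
    intro i j hij
    rw [Set.disjoint_left]
    rintro _ ⟨l, hl1, hl2, rfl⟩ ⟨l', hl1', hl2', hl3⟩
    have hl4 := hp.getVert_injOn (hl2'.trans (hlen _)) (hl2.trans (hlen _)) hl3
    have := hlt _ _ (hlow i j hij)
    omega
  have hne1 : ∀ i j, i ≠ j → lo i ≠ lo j := fun i j hij h => by
    simp only [lo, Fin.mk.injEq] at h
    exact hij (Fin.ext (by omega))
  have hne2 : ∀ i j, i ≠ j → hi i ≠ hi j := fun i j hij h => by
    simp only [hi, Fin.mk.injEq] at h
    exact hij (Fin.ext (by omega))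
  have hne3 : ∀ i j, lo i ≠ hi j := fun i j h => by
    simp only [lo, hi, Fin.mk.injEq] at h
    omega
  refine ⟨fun i => a (κ (lo i)), fun i => a (κ (hi i)),
    fun i => D (κ (lo i)) ∪ D (κ (hi i)) ∪ seg i, fun i => ⟨(h _).1, (h _).1, ?_, ?_⟩, ?_⟩
  · intro heq
    have heq' : a (κ (lo i)) = a (κ (hi i)) := heq
    refine Set.disjoint_left.1 (hD (hκinj.ne (hlohi i).ne)) (h _).2.2.1.left_mem ?_
    exact heq' ▸ (h (κ (hi i))).2.2.1.left_mem
  · refine (((h (κ (lo i))).2.2.1.mono_set ?_).trans ((hseg i).mono_set ?_)).trans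
      ((h (κ (hi i))).2.2.1.symm.mono_set ?_)
    · exact fun w hw => Or.inl (Or.inl hw)
    · exact fun w hw => Or.inr hw
    · exact fun w hw => Or.inl (Or.inr hw)
  · intro i j hij
    have hss : Disjoint (seg i) (seg j) := by
      rcases lt_or_gt_of_ne hij with h | h
      · exact hsegseg i j h
      · exact (hsegseg j i h).symm
    simp only [Function.onFun, Set.disjoint_union_left, Set.disjoint_union_right]
    refine ⟨⟨⟨⟨?_, ?_⟩, ?_⟩, ?_, ?_⟩, ?_, ?_⟩ <;> try refine ⟨?_, ?_⟩
    all_goals first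
      | exact hss
      | exact hD (hκinj.ne (hne1 i j hij))
      | exact hD (hκinj.ne (hne2 i j hij))
      | exact hD (hκinj.ne (hne3 i j))
      | exact hD (hκinj.ne (hne3 j i).symm)
      | exact hDseg j _ (hne1 i j hij) (hne3 i j)
      | exact hDseg j _ (hne3 j i).symm (hne2 i j hij)
      | exact (hDseg i _ (hne1 j i hij.symm) (hne3 j i)).symm
      | exact (hDseg i _ (hne3 i j).symm (hne2 j i hij.symm)).symm

/-- The number of vertices that suffice to hit all `A`-paths when no `c` of them are disjoint. -/
def hittingBound (c : ℕ) : ℕ := 2 * c * c + 3 * c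

/-- The Erdős–Pósa property of `A`-paths. -/
theorem exists_hitting_of_not_hasPacking [Finite V] (G : SimpleGraph V) (A : Set V) (c : ℕ)
    (hc : ¬ HasPacking G A c) :
    ∃ X : Set V, X.ncard ≤ hittingBound c ∧
      ∀ a ∈ A, ∀ b ∈ A, a ≠ b → ¬ ReachIn G Xᶜ a b := by
  classical
  obtain ⟨m, hmc, hm, hm'⟩ : ∃ m < c, HasPacking G A m ∧ ¬ HasPacking G A (m + 1) := by
    by_contra! hcon
    have : ∀ m ≤ c, HasPacking G A m := by
      intro m
      induction m with
      | zero => exact fun _ => ⟨Fin.elim0, Fin.elim0, Fin.elim0, fun j => j.elim0, fun j => j.elim0⟩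
      | succ m ih => exact fun h => hcon m (by omega) (ih (by omega))
    exact hc (this c le_rfl)
  obtain ⟨a, b, p, hp, hpd⟩ := hm.exists_paths
  set S : Set V := {v | ∃ j, v ∈ (p j).support} with hS
  set E : Set V := Set.range a ∪ Set.range b with hE
  -- By pigeonhole, `2 * m + 2` of the connections would land on the same one of the `m` paths.
  -- Pairing them along it gives `m + 1` disjoint `A`-paths, against the maximality of `m`.
  have hnolink : ¬ HasLinkage G (A \ E) S (m * (2 * m + 1) + 1) := by
    intro hL
    obtain ⟨a', s, D, hD, hDd⟩ := hL.first_hit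
    choose J hJ using fun j => (hD j).2.1
    obtain ⟨j, hj⟩ := Fintype.exists_lt_card_fiber_of_mul_lt_card (f := J) (n := 2 * m + 1)
      (by simp)
    set Φ := Finset.univ.filter fun x => J x = j with hΦ
    refine hm' ?_
    let e := Φ.orderEmbOfFin rfl
    have he : ∀ r, J (e r) = j := fun r =>
      (Finset.mem_filter.1 (Φ.orderEmbOfFin_mem rfl r)).2
    refine hasPacking_of_landing (m := m + 1) (p j) (hp j).2.2.2 (a' ∘ e) (s ∘ e) (D ∘ e) ?_
      (fun r r' hr => hDd (e.injective.ne hr)) (by omega)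
    intro r
    refine ⟨(hD _).1.1, ?_, (hD _).2.2.1, fun v hv hv' => (hD _).2.2.2.1 v hv ⟨j, hv'⟩⟩
    have := hJ (e r)
    rwa [he r] at this
  have hsep : ∃ T, Separates G (A \ E) S T ∧ T.ncard < m * (2 * m + 1) + 1 := by
    by_contra! h
    exact hnolink (hasLinkage_of_separates G _ _ _ h)
  obtain ⟨T, hT, hTc⟩ := hsep
  refine ⟨T ∪ E, ?_, ?_⟩
  · have h1 := Set.ncard_union_le T E
    have h2 := Set.ncard_union_le (Set.range a) (Set.range b)
    rw [← hE] at h2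
    have h3 : ∀ f : Fin m → V, (Set.range f).ncard ≤ m := fun f => by
      rw [← Set.image_univ]
      refine (Set.ncard_image_le (Set.toFinite _)).trans ?_
      rw [Set.ncard_univ, Nat.card_fin]
    have h4 := h3 a
    have h5 := h3 b
    unfold hittingBound
    have h6 : m * (2 * m + 1) ≤ c * (2 * c + 1) := by gcongr
    have h7 : c * (2 * c + 1) = 2 * c * c + c := by ring
    omega
  · intro x hx y hy hxy hr
    -- A connection avoiding `T` and `E` starts in `A \ E`, so it never meets the chosen paths and
    -- could be added to the packing.
    have hxE : x ∈ A \ E := ⟨hx, fun h => hr.left_mem (Or.inr h)⟩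
    have hr' : ReachIn G Sᶜ x y := by
      refine hr.inside_component.mono_set fun w hw hwS => ?_
      exact hT x hxE w hwS (ReachIn.mono_set hw fun v hv h => hv (Or.inl h))
    refine hm' (.of_family (ι := Option (Fin m)) (by simp) (fun o => o.elim x a)
      (fun o => o.elim y b) (fun o => o.elim Sᶜ fun j => {v | v ∈ (p j).support}) ?_ ?_)
    · rintro (_ | j)
      · exact ⟨hx, hy, hxy, hr'⟩
      · exact ⟨(hp j).1, (hp j).2.1, (hp j).2.2.1, .of_walk (p j) fun v hv => hv⟩
    · rintro (_ | i) (_ | j) hij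
      · exact absurd rfl hij
      · exact Set.disjoint_left.2 fun v hv hv' => hv ⟨j, hv'⟩
      · exact Set.disjoint_left.2 fun v hv hv' => hv' ⟨i, hv⟩
      · exact Set.disjoint_left.2 fun v hv hv' => hpd i j (fun h => hij (by rw [h])) hv hv'

end Packing

/-! ### Rooted trees, subtrees and tree decompositions. -/

section RootedTrees

/-- A tree given by its root, the parent of each other node, and the depth of each node. -/
structure ParentTree (N : Type*) where
  root : N
  parent : N → N
  depth : N → ℕ
  depth_root : depth root = 0
  depth_eq : ∀ x, x ≠ root → depth x = depth (parent x) + 1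

namespace ParentTree

variable {N : Type*} (R : ParentTree N)

/-- The underlying graph of a rooted tree. -/
def graph : SimpleGraph N where
  Adj x y := (x ≠ R.root ∧ R.parent x = y) ∨ (y ≠ R.root ∧ R.parent y = x)
  symm := ⟨fun _ _ h => h.symm⟩
  loopless := ⟨fun x h => by
    have h' : x ≠ R.root ∧ R.parent x = x := by tauto
    have := R.depth_eq x h'.1
    rw [h'.2] at this
    omega⟩

/-- `R.Anc t s` says that `t` is an ancestor of `s`, possibly `s` itself. -/
inductive Anc (t : N) : N → Prop
  | refl : Anc t t
  | child {s : N} : s ≠ R.root → Anc t (R.parent s) → Anc t s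

/-- `S` is a subtree with topmost node `τ`. -/
def IsSubtree (S : Set N) (τ : N) : Prop :=
  τ ∈ S ∧ ∀ x ∈ S, x ≠ τ → x ≠ R.root ∧ R.parent x ∈ S

variable {R} {S S' : Set N} {s t t' u τ τ' : N}

theorem Anc.depth_le (h : R.Anc t s) : R.depth t ≤ R.depth s := by
  induction h with
  | refl => exact le_rfl
  | child hs _ ih => rw [R.depth_eq _ hs]; omega

theorem Anc.eq_of_depth_le (h : R.Anc t s) (hd : R.depth s ≤ R.depth t) : t = s := by
  cases h with
  | refl => rfl
  | child hs h => have := h.depth_le; rw [R.depth_eq _ hs] at hd; omega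

theorem Anc.trans (h : R.Anc t s) (h' : R.Anc s u) : R.Anc t u := by
  induction h' with
  | refl => exact h
  | child hs _ ih => exact .child hs ih

theorem Anc.of_depth_le (h : R.Anc t s) (h' : R.Anc t' s) (hd : R.depth t ≤ R.depth t') :
    R.Anc t t' := by
  induction h' with
  | refl => exact h
  | child hs h' ih =>
    cases h with
    | refl => have := h'.depth_le; rw [R.depth_eq _ hs] at hd; omega
    | child _ h => exact ih h

theorem anc_parent (h : t ≠ R.root) : R.Anc (R.parent t) t := .child h .refl

theorem Anc.parent_of_ne (h : R.Anc t s) (hne : t ≠ s) : R.Anc t (R.parent s) := by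
  cases h with
  | refl => exact absurd rfl hne
  | child _ h => exact h

theorem IsSubtree.anc (h : R.IsSubtree S τ) (hs : s ∈ S) : R.Anc τ s := by
  induction hn : R.depth s using Nat.strong_induction_on generalizing s with
  | _ n ih =>
    by_cases hsτ : s = τ
    · rw [hsτ]; exact .refl
    · obtain ⟨h1, h2⟩ := h.2 s hs hsτ
      exact .child h1 (ih _ (by rw [← hn, R.depth_eq s h1]; omega) h2 rfl)

/-- A subtree contains the nodes on the way up from one of its nodes to its top. -/
theorem IsSubtree.mem_of_anc (h : R.IsSubtree S τ) (hs : s ∈ S) (hu : R.Anc u s)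
    (hd : R.depth τ ≤ R.depth u) : u ∈ S := by
  induction hu with
  | refl => exact hs
  | @child s hsr hu ih =>
    by_cases hsτ : s = τ
    · have := hu.depth_le
      rw [← hsτ, R.depth_eq s hsr] at hd
      omega
    · exact ih (h.2 s hs hsτ).2

theorem IsSubtree.eq_top (h : R.IsSubtree S τ) (ht : t ∈ S) (hp : t = R.root ∨ R.parent t ∉ S) :
    t = τ := by
  by_contra hne
  obtain ⟨h1, h2⟩ := h.2 t ht hne
  tauto

theorem graph_adj_parent (h : t ≠ R.root) : R.graph.Adj t (R.parent t) := Or.inl ⟨h, rfl⟩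

theorem IsSubtree.reachIn (h : R.IsSubtree S τ) (hs : s ∈ S) : ReachIn R.graph S τ s := by
  have key : ∀ {s}, R.Anc τ s → s ∈ S → ReachIn R.graph S τ s := by
    intro s hs
    induction hs with
    | refl => exact .refl
    | @child s hsr ha ih =>
      intro hS
      by_cases hsτ : s = τ
      · subst hsτ; exact .refl hS
      · exact (ih (h.2 s hS hsτ).2).tail (graph_adj_parent hsr).symm hS
  exact key (h.anc hs) hs

theorem IsSubtree.connected (h : R.IsSubtree S τ) : (R.graph.induce S).Connected :=
  ReachIn.connected_of h.1 fun _ hy => h.reachIn hy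

theorem graph_connected (R : ParentTree N) : R.graph.Connected := by
  have h : R.IsSubtree Set.univ R.root := ⟨trivial, fun x _ hx => ⟨hx, trivial⟩⟩
  have : Nonempty N := ⟨R.root⟩
  refine ⟨fun a b => ?_⟩
  obtain ⟨p, -⟩ := (h.reachIn (s := a) trivial).symm.exists_walk
  obtain ⟨q, -⟩ := (h.reachIn (s := b) trivial).exists_walk
  exact ⟨p.append q⟩

theorem graph_isTree [Finite N] (R : ParentTree N) : R.graph.IsTree := by
  rw [SimpleGraph.isTree_iff_connected_and_card]
  refine ⟨R.graph_connected, le_antisymm ?_ R.graph_connected.card_vert_le_card_edgeSet_add_one⟩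
  have h1 : R.graph.edgeSet ⊆ (fun x => s(x, R.parent x)) '' {R.root}ᶜ := by
    intro e
    induction e with
    | _ x y =>
      rintro (⟨h1, h2⟩ | ⟨h1, h2⟩)
      · exact ⟨x, h1, by simp [h2]⟩
      · exact ⟨y, h1, by simp [h2, Sym2.eq_swap]⟩
  have h2 := (Set.ncard_le_ncard h1 (Set.toFinite _)).trans (Set.ncard_image_le (Set.toFinite _))
  have h3 := Set.ncard_add_ncard_compl ({R.root} : Set N)
  rw [Set.ncard_singleton] at h3
  rw [Nat.card_coe_set_eq]
  omega

theorem depth_le_of_walk {x y : N} (p : R.graph.Walk x y) :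
    R.depth y ≤ R.depth x + p.length := by
  induction p with
  | nil => simp
  | cons h p ih =>
    rw [SimpleGraph.Walk.length_cons]
    rcases h with ⟨h1, h2⟩ | ⟨h1, h2⟩
    · have := R.depth_eq _ h1
      rw [h2] at this
      omega
    · have := R.depth_eq _ h1
      rw [h2] at this
      omega

theorem dist_root (x : N) : R.graph.dist R.root x = R.depth x := by
  apply le_antisymm
  · induction hn : R.depth x generalizing x with
    | zero =>
      by_cases h : x = R.root
      · rw [h, SimpleGraph.dist_self]
      · have := R.depth_eq x h
        omega
    | succ n ih =>
      have h : x ≠ R.root := fun h => by rw [h, R.depth_root] at hn; omega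
      have h1 := ih (R.parent x) (by have := R.depth_eq x h; omega)
      have h2 := R.graph_connected.dist_triangle (u := R.root) (v := R.parent x) (w := x)
      have h3 := SimpleGraph.dist_eq_one_iff_adj.2 (graph_adj_parent h).symm
      omega
  · obtain ⟨p, hp⟩ := R.graph_connected.exists_walk_length_eq_dist R.root x
    have := depth_le_of_walk p
    rw [R.depth_root] at this
    omega

theorem isChild_iff : IsChild R.graph R.root t t' ↔ t' ≠ R.root ∧ R.parent t' = t := by
  unfold IsChild
  rw [dist_root, dist_root]
  constructor
  · rintro ⟨⟨h1, h2⟩ | h, hd⟩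
    · have := R.depth_eq t h1
      rw [h2] at this
      omega
    · exact h
  · rintro ⟨h1, h2⟩
    exact ⟨Or.inr ⟨h1, h2⟩, by rw [R.depth_eq t' h1, h2]⟩

/-- A connected set of nodes is a subtree. -/
theorem exists_isSubtree (hS : (R.graph.induce S).Connected) : ∃ τ, R.IsSubtree S τ := by
  obtain ⟨x₀⟩ := hS.nonempty
  obtain ⟨τ, hτ, hmin⟩ : ∃ τ ∈ S, ∀ s ∈ S, R.depth τ ≤ R.depth s := by
    have hne : (R.depth '' S).Nonempty := ⟨_, x₀, x₀.2, rfl⟩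
    obtain ⟨τ, hτ, h⟩ := Nat.sInf_mem hne
    exact ⟨τ, hτ, fun s hs => h ▸ Nat.sInf_le ⟨s, hs, rfl⟩⟩
  refine ⟨τ, hτ, fun x hx hne => ?_⟩
  by_contra hcon
  -- If the parent of `x` is not in `S`, a walk in `S` from `x` cannot leave the descendants of `x`.
  -- So `τ` lies below `x`, and its minimal depth forces equality.
  have key : ∀ {y}, ReachIn R.graph S x y → R.Anc x y := by
    intro y hy
    induction hy with
    | refl => exact .refl
    | @tail y z h hadj hz ih =>
      rcases hadj with ⟨h1, h2⟩ | ⟨h1, h2⟩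
      · by_cases hxy : x = y
        · subst hxy
          exact absurd ⟨h1, h2 ▸ hz⟩ hcon
        · exact h2 ▸ ih.parent_of_ne hxy
      · exact .child h1 (h2 ▸ ih)
  exact hne ((key (.of_connected hS hx hτ)).eq_of_depth_le (hmin x hx))

/-- Transport of a rooted tree along a bijection. -/
def map {N' : Type*} (R : ParentTree N) (e : N ≃ N') : ParentTree N' where
  root := e R.root
  parent x := e (R.parent (e.symm x))
  depth x := R.depth (e.symm x)
  depth_root := by simp [R.depth_root]
  depth_eq x hx := by
    rw [R.depth_eq (e.symm x) fun h => hx (by rw [← h, e.apply_symm_apply])]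
    simp

theorem IsSubtree.map {N' : Type*} (e : N ≃ N') (h : R.IsSubtree S τ) :
    (R.map e).IsSubtree {x | e.symm x ∈ S} (e τ) := by
  refine ⟨by simpa using h.1, fun x hx hne => ?_⟩
  obtain ⟨h1, h2⟩ := h.2 (e.symm x) hx fun h => hne (by rw [← h, e.apply_symm_apply])
  refine ⟨fun h => h1 ?_, ?_⟩
  · rw [h]
    exact e.symm_apply_apply _
  · simpa [ParentTree.map] using h2

end ParentTree

/-- Every tree can be rooted at any of its nodes. -/
theorem SimpleGraph.IsTree.exists_parentTree {N : Type*} {T : SimpleGraph N} (hT : T.IsTree)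
    (r : N) : ∃ R : ParentTree N, R.root = r ∧ R.graph = T := by
  have hex : ∀ x, ∃ y, x ≠ r → T.Adj y x ∧ T.dist r x = T.dist r y + 1 := by
    intro x
    by_cases hx : x = r
    · exact ⟨x, fun h => absurd hx h⟩
    · obtain ⟨p, hp⟩ := hT.connected.exists_walk_length_eq_dist r x
      have hnil : ¬ p.Nil := SimpleGraph.Walk.not_nil_of_ne (Ne.symm hx)
      refine ⟨p.penultimate, fun _ => ⟨p.adj_penultimate hnil, ?_⟩⟩
      have h1 := SimpleGraph.dist_le p.dropLast
      have h2 := SimpleGraph.Walk.length_dropLast_add_one hnil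
      have h3 := hT.dist_eq_dist_add_one_of_adj r (p.adj_penultimate hnil)
      omega
  choose par hpar using hex
  -- Both candidates for the parent are penultimate on a path from `r` to `x`, and a tree has only
  -- one such path.
  have huniq : ∀ x y, T.Adj y x → T.dist r x = T.dist r y + 1 → y = par x := by
    intro x y hadj hd
    have hx : x ≠ r := fun h => by rw [h, SimpleGraph.dist_self] at hd; omega
    have hpath : ∀ z (h : T.Adj z x), T.dist r x = T.dist r z + 1 →
        ∃ q : T.Walk r x, q.IsPath ∧ q.penultimate = z := by
      intro z h hz
      obtain ⟨p, hp⟩ := hT.connected.exists_walk_length_eq_dist r z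
      refine ⟨p.concat h, SimpleGraph.Walk.isPath_of_length_eq_dist _ ?_, by simp⟩
      rw [SimpleGraph.Walk.length_concat, hp, hz]
    obtain ⟨q₁, h1, h2⟩ := hpath y hadj hd
    obtain ⟨q₂, h3, h4⟩ := hpath _ (hpar x hx).1 (hpar x hx).2
    have := congrArg Subtype.val ((hT.isAcyclic.subsingleton_path r x).elim ⟨q₁, h1⟩ ⟨q₂, h3⟩)
    rw [← h2, ← h4]
    exact congrArg _ this
  let R : ParentTree N :=
    { root := r
      parent := par
      depth := T.dist r
      depth_root := SimpleGraph.dist_self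
      depth_eq := fun x hx => (hpar x hx).2 }
  refine ⟨R, rfl, ?_⟩
  ext x y
  constructor
  · rintro (⟨h1, h2⟩ | ⟨h1, h2⟩)
    · exact h2 ▸ (hpar x h1).1.symm
    · exact h2 ▸ (hpar y h1).1
  · intro h
    rcases hT.dist_eq_dist_add_one_of_adj r h with hd | hd
    · refine Or.inl ⟨fun hx => ?_, (huniq x y h.symm hd).symm⟩
      rw [hx, SimpleGraph.dist_self] at hd
      omega
    · refine Or.inr ⟨fun hx => ?_, (huniq y x h hd).symm⟩
      rw [hx, SimpleGraph.dist_self] at hd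
      omega

variable {V : Type u} {G : SimpleGraph V}

/-- The tree decomposition with the given rooted tree and bags. -/
def TreeDecomposition.ofRooted {N : Type} [Finite N] (R : ParentTree N) (bag : N → Set V)
    (hbag : ∀ x, ∃ τ, R.IsSubtree {t | x ∈ bag t} τ)
    (hedge : ∀ x y, G.Adj x y → ∃ t, x ∈ bag t ∧ y ∈ bag t) : TreeDecomposition G where
  Node := N
  finite_node := inferInstance
  tree := R.graph
  isTree := R.graph_isTree
  bag := bag
  bag_connected x := (hbag x).elim fun _ h => h.connected
  bag_edge := hedge

theorem treewidthAtMost_of_rooted {N : Type w} [Finite N] (R : ParentTree N) (bag : N → Set V)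
    (hbag : ∀ x, ∃ τ, R.IsSubtree {t | x ∈ bag t} τ)
    (hedge : ∀ x y, G.Adj x y → ∃ t, x ∈ bag t ∧ y ∈ bag t) {k : ℕ}
    (hk : ∀ t, (bag t).encard ≤ k + 1) : TreewidthAtMost G k := by
  -- Nodes of a `TreeDecomposition` live in `Type`, so a tree in another universe is transported to
  -- some `Fin n`.
  let e := Finite.equivFin N
  refine ⟨.ofRooted (R.map e) (fun t => bag (e.symm t)) (fun x => ?_) (fun x y h => ?_),
    fun t => hk (e.symm t)⟩
  · obtain ⟨τ, h⟩ := hbag x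
    exact ⟨e τ, h.map e⟩
  · obtain ⟨t, h⟩ := hedge x y h
    exact ⟨e t, by simpa using h⟩

/-- A tree decomposition in rooted form: every vertex occupies a subtree. -/
theorem TreeDecomposition.exists_rooted (D : TreeDecomposition G) (r : D.Node) :
    ∃ R : ParentTree D.Node, R.root = r ∧ R.graph = D.tree ∧
      ∃ top : V → D.Node, ∀ x, R.IsSubtree {t | x ∈ D.bag t} (top x) := by
  obtain ⟨R, hr, hR⟩ := D.isTree.exists_parentTree r
  refine ⟨R, hr, hR, ?_⟩
  have : ∀ x, ∃ τ, R.IsSubtree {t | x ∈ D.bag t} τ := fun x =>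
    R.exists_isSubtree (by rw [hR]; exact D.bag_connected x)
  exact ⟨fun x => (this x).choose, fun x => (this x).choose_spec⟩

theorem TreeDecomposition.nonempty_node (D : TreeDecomposition G) : Nonempty D.Node :=
  D.isTree.connected.nonempty

theorem TreewidthAtMost.mono {k l : ℕ} (h : TreewidthAtMost G k) (hkl : k ≤ l) :
    TreewidthAtMost G l := by
  obtain ⟨D, hD⟩ := h
  refine ⟨D, fun t => (hD t).trans ?_⟩
  gcongr

/-- The nodes whose bags meet a connected set of vertices are connected. -/
theorem TreeDecomposition.connected_of_reachIn (D : TreeDecomposition G) {B : Set V} {x₀ : V}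
    (hx₀ : x₀ ∈ B) (hB : ∀ y ∈ B, ReachIn G B x₀ y) :
    (D.tree.induce {t | ∃ x ∈ B, x ∈ D.bag t}).Connected := by
  obtain ⟨⟨t₀, ht₀⟩⟩ := (D.bag_connected x₀).nonempty
  have hbag : ∀ x ∈ B, ∀ t t', x ∈ D.bag t → x ∈ D.bag t' →
      ReachIn D.tree {t | ∃ x ∈ B, x ∈ D.bag t} t t' := by
    intro x hx t t' ht ht'
    exact (ReachIn.of_connected (D.bag_connected x) ht ht').mono_set fun s hs => ⟨x, hx, hs⟩
  have key : ∀ {y}, ReachIn G B x₀ y → ∀ t, y ∈ D.bag t →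
      ReachIn D.tree {t | ∃ x ∈ B, x ∈ D.bag t} t₀ t := by
    intro y hy
    induction hy with
    | refl => exact fun t ht => hbag x₀ hx₀ t₀ t ht₀ ht
    | tail h hadj hz ih =>
      intro t ht
      obtain ⟨s, h1, h2⟩ := D.bag_edge _ _ hadj
      exact (ih s h1).trans (hbag _ hz s t h2 ht)
  refine ReachIn.connected_of ⟨x₀, hx₀, ht₀⟩ ?_
  rintro t ⟨y, hy, ht⟩
  exact key (hB y hy) t ht

/-- The nodes whose bags meet a nonempty set of pairwise adjacent vertices are connected. -/
theorem TreeDecomposition.connected_of_isClique (D : TreeDecomposition G) {B : Set V}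
    (hne : B.Nonempty) (hB : G.IsClique B) :
    (D.tree.induce {t | ∃ x ∈ B, x ∈ D.bag t}).Connected := by
  obtain ⟨x₀, hx₀⟩ := hne
  refine D.connected_of_reachIn hx₀ fun y hy => ?_
  by_cases h : x₀ = y
  · subst h; exact .refl hx₀
  · exact (ReachIn.refl hx₀).tail (hB hx₀ hy h) hy

/-- Disjoint, pairwise touching, connected vertex sets bound the treewidth from below. -/
theorem card_le_of_touching {k c : ℕ} (htw : TreewidthAtMost G c) (B : Fin k → Set V)
    (x₀ : Fin k → V) (hx₀ : ∀ j, x₀ j ∈ B j) (hB : ∀ j, ∀ y ∈ B j, ReachIn G (B j) (x₀ j) y)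
    (hdisj : Pairwise (Function.onFun Disjoint B))
    (htouch : ∀ i j, i ≠ j → ∃ x ∈ B i, ∃ y ∈ B j, G.Adj x y) : k ≤ c + 1 := by
  obtain ⟨D, hD⟩ := htw
  obtain ⟨r⟩ := D.nonempty_node
  obtain ⟨R, -, hR, -⟩ := D.exists_rooted r
  have hsub : ∀ j, ∃ τ, R.IsSubtree {t | ∃ x ∈ B j, x ∈ D.bag t} τ := fun j =>
    R.exists_isSubtree (by rw [hR]; exact D.connected_of_reachIn (hx₀ j) (hB j))
  choose τ hτ using hsub
  rcases Nat.eq_zero_or_pos k with hk | hk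
  · omega
  have : Nonempty (Fin k) := ⟨⟨0, hk⟩⟩
  -- Helly property: the subtrees of the sets `B i` intersect pairwise, so the deepest of their tops
  -- lies in all of them. Its bag contains a vertex of each of these disjoint sets.
  obtain ⟨j, hj⟩ := Finite.exists_max fun j => R.depth (τ j)
  have hmeet : ∀ i, ∃ x ∈ B i, x ∈ D.bag (τ j) := by
    intro i
    by_cases hij : i = j
    · subst hij
      exact (hτ i).1
    · obtain ⟨x, hx, y, hy, hadj⟩ := htouch i j hij
      obtain ⟨s, h1, h2⟩ := D.bag_edge x y hadj
      exact (hτ i).mem_of_anc (s := s) ⟨x, hx, h1⟩ ((hτ j).anc ⟨y, hy, h2⟩) (hj i)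
  choose f hf hfD using hmeet
  have hinj : Function.Injective f := by
    intro i i' h
    by_contra hne
    exact Set.disjoint_left.1 (hdisj hne) (hf i) (h ▸ hf i')
  have h1 : (Set.range f).encard = k := by
    rw [← Set.image_univ, hinj.encard_image, Set.encard_univ, ENat.card_eq_coe_fintype_card,
      Fintype.card_fin]
  have h2 : Set.range f ⊆ D.bag (τ j) := by
    rintro _ ⟨i, rfl⟩
    exact hfD i
  have h3 := (Set.encard_le_encard h2).trans (hD (τ j))
  rw [h1] at h3
  exact_mod_cast h3

end RootedTrees

/-! ### Greedy coloring of graphs of bounded treewidth. -/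

section Quotients

variable {V : Type u} {G : SimpleGraph V}

/-- A graph of treewidth at most `c` has a proper coloring with `c + 1` colors. -/
theorem TreewidthAtMost.exists_coloring [Finite V] {c : ℕ} (h : TreewidthAtMost G c) :
    ∃ χ : V → Fin (c + 1), ∀ x y, G.Adj x y → χ x ≠ χ y := by
  classical
  obtain ⟨D, hD⟩ := h
  obtain ⟨r⟩ := D.nonempty_node
  obtain ⟨R, -, -, top, htop⟩ := D.exists_rooted r
  have key : ∀ n, ∀ W : Finset V, W.card = n →
      ∃ χ : V → Fin (c + 1), ∀ x ∈ W, ∀ y ∈ W, G.Adj x y → χ x ≠ χ y := by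
    intro n
    induction n with
    | zero =>
      intro W hW
      rw [Finset.card_eq_zero] at hW
      subst hW
      exact ⟨fun _ => 0, by simp⟩
    | succ n ih =>
      intro W hW
      -- The neighbors in `W` of a vertex with deepest top all lie in the bag of that top, so there
      -- are at most `c` of them and one color remains free.
      obtain ⟨v, hv, hmax⟩ := W.exists_max_image (fun x => R.depth (top x))
        (Finset.card_pos.1 (by omega))
      obtain ⟨χ, hχ⟩ := ih (W.erase v) (by rw [Finset.card_erase_of_mem hv, hW]; rfl)
      set Nb : Set V := {u | u ∈ W ∧ G.Adj u v} with hNb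
      have hsub : insert v Nb ⊆ D.bag (top v) := by
        rintro u (rfl | ⟨hu, hadj⟩)
        · exact (htop u).1
        · obtain ⟨s, h1, h2⟩ := D.bag_edge u v hadj
          exact (htop u).mem_of_anc h1 ((htop v).anc h2) (hmax u hu)
      have hcard : Nb.ncard ≤ c := by
        have h1 := (Set.encard_le_encard hsub).trans (hD (top v))
        rw [Set.encard_insert_of_notMem fun h => G.irrefl h.2,
          ← (Set.toFinite Nb).cast_ncard_eq] at h1
        have h2 : Nb.ncard + 1 ≤ c + 1 := by exact_mod_cast h1
        omega
      have hcol : ∃ i : Fin (c + 1), i ∉ χ '' Nb := by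
        by_contra! hcon
        have h1 : χ '' Nb = Set.univ := Set.eq_univ_of_forall hcon
        have h2 := Set.ncard_image_le (f := χ) (Set.toFinite Nb)
        rw [h1, Set.ncard_univ, Nat.card_fin] at h2
        omega
      obtain ⟨i, hi⟩ := hcol
      refine ⟨Function.update χ v i, fun x hx y hy hadj => ?_⟩
      by_cases hxv : x = v
      · subst hxv
        rw [Function.update_self, Function.update_of_ne hadj.ne']
        exact fun h => hi ⟨y, ⟨hy, hadj.symm⟩, h.symm⟩
      · by_cases hyv : y = v
        · subst hyv
          rw [Function.update_self, Function.update_of_ne hxv]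
          exact fun h => hi ⟨x, ⟨hx, hadj⟩, h⟩
        · rw [Function.update_of_ne hxv, Function.update_of_ne hyv]
          exact hχ x (Finset.mem_erase.2 ⟨hxv, hx⟩) y (Finset.mem_erase.2 ⟨hyv, hy⟩) hadj
  have := Fintype.ofFinite V
  obtain ⟨χ, hχ⟩ := key _ Finset.univ rfl
  exact ⟨χ, fun x y => hχ x (Finset.mem_univ _) y (Finset.mem_univ _)⟩

end Quotients

/-! ### From guarded cutvertex decompositions to the treewidth of the spasm. -/

namespace ColoredGraph

variable {C : Type v} {H F : ColoredGraph.{u, v} C}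

/-- Each node `t` of a guarded cutvertex decomposition becomes a star, whose center carries the
images of the guards of `t` and whose leaves carry one further vertex each. -/
def starTree {T : Type*} (R : ParentTree T) {X : Type*} (link : T → X) :
    ParentTree (T × Option X) where
  root := (R.root, none)
  parent p := match p with
    | (t, some _) => (t, none)
    | (t, none) => (R.parent t, some (link t))
  depth p := 2 * R.depth p.1 + (if p.2.isSome then 1 else 0)
  depth_root := by simp [R.depth_root]
  depth_eq := by
    rintro ⟨t, _ | x⟩ h
    · have ht : t ≠ R.root := fun h' => h (by rw [h'])
      have := R.depth_eq t ht
      simp only [Option.isSome_none, Option.isSome_some, if_true]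
      simp
      omega
    · simp

/-- Below the top node `τ` of the fibre of `y`, the vertex `y` has a preimage in every separator it
crosses, and separators are guarded. So `y` can be an unguarded image only at `τ`, where a single
leaf represents it. -/
theorem treewidthAtMost_of_guarded (D : H.GuardedCutvertexDecomposition) {c : ℕ}
    (hD : D.GuardSizeAtMost c) (hF : F ∈ H.spasm) : TreewidthAtMost F.graph c := by
  classical
  obtain ⟨f, hsurj, hedge, hcol⟩ := hF
  have := F.finite_V
  have := D.finite_node
  obtain ⟨R, hroot, hgraph, top, htop⟩ := D.toTreeDecomposition.exists_rooted D.root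
  have hsep : ∀ t, t ≠ R.root → ∀ x, x ∈ D.bag t → x ∈ D.bag (R.parent t) →
      x ∈ D.toTreeDecomposition.separator D.root t := by
    intro t ht x h1 h2
    refine ⟨R.parent t, ?_, h1, h2⟩
    rw [← hroot, ← hgraph]
    exact ParentTree.isChild_iff.2 ⟨ht, rfl⟩
  have huniq : ∀ t, t ≠ R.root → ∀ x y, x ∈ D.bag t → x ∈ D.bag (R.parent t) →
      y ∈ D.bag t → y ∈ D.bag (R.parent t) → x ∉ D.guard (R.parent t) →
      y ∉ D.guard (R.parent t) → x = y := by
    intro t ht x y hx hx' hy hy' hxg hyg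
    have hch : IsChild D.tree D.root (R.parent t) t := by
      rw [← hroot, ← hgraph]
      exact ParentTree.isChild_iff.2 ⟨ht, rfl⟩
    have := D.separator_diff_guard _ _ hch
    rw [Set.encard_le_one_iff] at this
    exact this x y ⟨hsep t ht x hx hx', hxg⟩ ⟨hsep t ht y hy hy', hyg⟩
  -- Vertices of one fibre have the same color, so some bag contains both `x` and `x'`. Hence if the
  -- fibre meets the bags of `t` and of its parent, one vertex of it lies in both.
  have hlift : ∀ t, t ≠ R.root → ∀ x x', f x = f x' → x ∈ D.bag t → x' ∈ D.bag (R.parent t) →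
      ∃ z, f z = f x ∧ z ∈ D.bag t ∧ z ∈ D.bag (R.parent t) := by
    intro t ht x x' hxx hx hx'
    by_cases h1 : x ∈ D.bag (R.parent t)
    · exact ⟨x, rfl, hx, h1⟩
    refine ⟨x', hxx.symm, ?_, hx'⟩
    have htx : t = top x := (htop x).eq_top hx (Or.inr h1)
    have hne : x ≠ x' := fun h => h1 (h ▸ hx')
    obtain ⟨s, hs, hs'⟩ := D.bag_edge x x' ⟨hne, Or.inr (by rw [← hcol, ← hcol, hxx])⟩
    refine (htop x').mem_of_anc hs' (htx ▸ (htop x).anc hs) ?_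
    have h2 := ((htop x').anc hx').depth_le
    have h3 := R.depth_eq t ht
    omega
  have htopF : ∀ y : F.V, ∃ τ, R.IsSubtree {t | ∃ x ∈ {x | f x = y}, x ∈ D.bag t} τ := by
    intro y
    refine R.exists_isSubtree ?_
    rw [hgraph]
    refine D.toTreeDecomposition.connected_of_isClique (hsurj y) fun x hx x' hx' hne => ?_
    exact ⟨hne, Or.inr (by rw [← hcol, ← hcol, hx, hx'])⟩
  -- `link t` selects the leaf of the parent's star to which `t` is attached: that of the only
  -- separator vertex unguarded there, or the dummy leaf `none` if there is none.
  let link : D.Node → Option F.V := fun t =>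
    if h : ∃ x, x ∈ D.bag t ∧ x ∈ D.bag (R.parent t) ∧ x ∉ D.guard (R.parent t) then
      some (f h.choose) else none
  have hlink : ∀ t, t ≠ R.root → ∀ x, x ∈ D.bag t → x ∈ D.bag (R.parent t) →
      x ∉ D.guard (R.parent t) → link t = some (f x) := by
    intro t ht x h1 h2 h3
    have h : ∃ x, x ∈ D.bag t ∧ x ∈ D.bag (R.parent t) ∧ x ∉ D.guard (R.parent t) :=
      ⟨x, h1, h2, h3⟩
    simp only [link, dif_pos h]
    rw [huniq t ht _ x h.choose_spec.1 h.choose_spec.2.1 h1 h2 h.choose_spec.2.2 h3]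
  let bag : D.Node × Option (Option F.V) → Set F.V := fun p =>
    f '' D.guard p.1 ∪ {y | p.2 = some (some y) ∧ y ∈ f '' D.bag p.1}
  refine treewidthAtMost_of_rooted (starTree R link) bag (fun y => ?_) (fun a b hab => ?_) ?_
  · obtain ⟨τ, hτ⟩ := htopF y
    have hguard : ∀ t, y ∈ f '' D.bag t → t ≠ τ → t ≠ R.root ∧ R.parent t ≠ t ∧
        ∃ z, f z = y ∧ z ∈ D.bag t ∧ z ∈ D.bag (R.parent t) ∧ z ∈ D.guard t := by
      rintro t ⟨x, hx, hxy⟩ ht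
      obtain ⟨h1, x', h2, h3⟩ := hτ.2 t ⟨x, hxy, hx⟩ ht
      obtain ⟨z, hz1, hz2, hz3⟩ := hlift t h1 x x' (hxy.trans h2.symm) hx h3
      refine ⟨h1, fun h => ?_, z, hz1.trans hxy, hz2, hz3,
        D.separator_subset_guard t (hsep t h1 z hz2 hz3)⟩
      have := R.depth_eq t h1
      rw [h] at this
      omega
    obtain ⟨xτ, hxτ, hxτ'⟩ := hτ.1
    let T : D.Node × Option (Option F.V) :=
      (τ, if y ∈ f '' D.guard τ then none else some (some y))
    refine ⟨T, ?_, ?_⟩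
    · by_cases h : y ∈ f '' D.guard τ
      · exact Or.inl h
      · refine Or.inr ⟨?_, xτ, hxτ', hxτ⟩
        simp only [T, if_neg h]
    · rintro ⟨t, _ | o⟩ hy hne
      · have hyg : y ∈ f '' D.guard t := by
          rcases hy with h | h
          · exact h
          · exact absurd h.1 (by simp)
        have htτ : t ≠ τ := by
          rintro rfl
          exact hne (by simp only [T, if_pos hyg])
        obtain ⟨h1, -, z, hz1, hz2, hz3, -⟩ :=
          hguard t (Set.image_mono (D.guard_subset_bag t) hyg) htτ
        refine ⟨fun h => h1 (congrArg Prod.fst h), ?_⟩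
        by_cases hz4 : z ∈ D.guard (R.parent t)
        · exact Or.inl ⟨z, hz4, hz1⟩
        · refine Or.inr ⟨?_, z, hz3, hz1⟩
          change some (link t) = _
          rw [hlink t h1 z hz2 hz3 hz4, hz1]
      · refine ⟨fun h => by simpa [starTree] using congrArg Prod.snd h, Or.inl ?_⟩
        change y ∈ f '' D.guard t
        rcases hy with h | ⟨h1, h2⟩
        · exact h
        · by_cases htτ : t = τ
          · subst htτ
            by_contra hcon
            refine hne ?_
            simp only [T, if_neg hcon]
            exact congrArg _ h1
          · obtain ⟨-, -, z, hz1, -, -, hz4⟩ := hguard t h2 htτ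
            exact ⟨z, hz4, hz1⟩
  · obtain ⟨x, y, hxy, rfl, rfl⟩ := hedge a b hab
    obtain ⟨t, hx, hy⟩ := D.bag_edge x y ⟨hxy.ne, Or.inl hxy⟩
    rcases D.guard_isVertexCover t (v := ⟨x, hx⟩) (w := ⟨y, hy⟩) hxy with h | h
    · exact ⟨(t, some (some (f y))), Or.inl ⟨x, h, rfl⟩, Or.inr ⟨rfl, y, hy, rfl⟩⟩
    · exact ⟨(t, some (some (f x))), Or.inr ⟨rfl, x, hx, rfl⟩, Or.inl ⟨y, h, rfl⟩⟩
  · rintro ⟨t, o⟩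
    refine (Set.encard_union_le _ _).trans (add_le_add ((Set.encard_image_le _ _).trans (hD t)) ?_)
    rw [Set.encard_le_one_iff]
    rintro a b ⟨ha, -⟩ ⟨hb, -⟩
    simp only at ha hb
    rw [ha] at hb
    simpa using hb

end ColoredGraph

/-! ### Quotients in the spasm, the contraction and flowers. -/

namespace ColoredGraph

variable {C : Type v} {H F K : ColoredGraph.{u, v} C}

/-- The quotient of `H` by the fibres of `φ`, which are monochromatic and independent. -/
def quotient (H : ColoredGraph.{u, v} C) (φ : H.V → H.V)
    (_hcol : ∀ v, H.color (φ v) = H.color v) (hadj : ∀ u v, H.graph.Adj u v → φ u ≠ φ v) :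
    ColoredGraph.{u, v} C where
  V := Set.range φ
  finite_V := by
    have := H.finite_V
    exact Set.toFinite (Set.range φ)
  graph :=
    { Adj := fun p q => ∃ x y, H.graph.Adj x y ∧ φ x = p ∧ φ y = q
      symm := ⟨fun _ _ ⟨x, y, h, hx, hy⟩ => ⟨y, x, h.symm, hy, hx⟩⟩
      loopless := ⟨fun _ ⟨x, y, h, hx, hy⟩ => hadj x y h (hx.trans hy.symm)⟩ }
  color p := H.color p

theorem quotient_mem_spasm (φ : H.V → H.V) (hcol : ∀ v, H.color (φ v) = H.color v)
    (hadj : ∀ u v, H.graph.Adj u v → φ u ≠ φ v) : H.quotient φ hcol hadj ∈ H.spasm := by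
  refine ⟨⟨Set.rangeFactorization φ, fun {x y} h => ⟨x, y, h, rfl, rfl⟩⟩,
    Set.rangeFactorization_surjective, ?_, hcol⟩
  rintro a b ⟨x, y, h, hx, hy⟩
  exact ⟨x, y, h, Subtype.ext hx, Subtype.ext hy⟩

theorem self_mem_spasm (H : ColoredGraph.{u, v} C) : H ∈ H.spasm :=
  ⟨SimpleGraph.Hom.id, Function.surjective_id, fun a b h => ⟨a, b, h, rfl, rfl⟩, fun _ => rfl⟩

theorem spasm_trans (hF : F ∈ H.spasm) (hK : K ∈ F.spasm) : K ∈ H.spasm := by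
  obtain ⟨f, hf1, hf2, hf3⟩ := hF
  obtain ⟨g, hg1, hg2, hg3⟩ := hK
  refine ⟨g.comp f, hg1.comp hf1, fun a b hab => ?_, fun x => (hg3 _).trans (hf3 x)⟩
  obtain ⟨x, y, hxy, rfl, rfl⟩ := hg2 a b hab
  obtain ⟨z, w, hzw, rfl, rfl⟩ := hf2 x y hxy
  exact ⟨z, w, hzw, rfl, rfl⟩

/-- Two nonadjacent vertices of the same color can be merged. -/
theorem exists_merge (hF : F ∈ H.spasm) {u v : F.V} (huv : u ≠ v) (hcol : F.color u = F.color v)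
    (hadj : ¬ F.graph.Adj u v) :
    ∃ K ∈ H.spasm, Nat.card K.V < Nat.card F.V ∧ ∃ π : F.V → K.V, π u = π v ∧
      (∀ x y, F.graph.Adj x y → K.graph.Adj (π x) (π y)) ∧ (∀ x, K.color (π x) = F.color x) ∧
      ∀ x y, π x = π y → x = y ∨ (x = u ∧ y = v) ∨ (x = v ∧ y = u) := by
  classical
  have := F.finite_V
  let φ : F.V → F.V := fun x => if x = v then u else x
  have hinj : ∀ x y, φ x = φ y → x = y ∨ (x = u ∧ y = v) ∨ (x = v ∧ y = u) := by
    intro x y h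
    by_cases h1 : x = v <;> by_cases h2 : y = v <;> simp only [φ, h1, h2, if_true, if_false] at h
    · exact Or.inl (h1.trans h2.symm)
    · exact Or.inr (Or.inr ⟨h1, h.symm⟩)
    · exact Or.inr (Or.inl ⟨h, h2⟩)
    · exact Or.inl h
  have hcol' : ∀ x, F.color (φ x) = F.color x := by
    intro x
    by_cases h : x = v
    · simp only [φ, h, if_true, hcol]
    · simp only [φ, h, if_false]
  have hadj' : ∀ x y, F.graph.Adj x y → φ x ≠ φ y := by
    intro x y h heq
    rcases hinj x y heq with h1 | ⟨rfl, rfl⟩ | ⟨rfl, rfl⟩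
    · exact h.ne h1
    · exact hadj h
    · exact hadj h.symm
  refine ⟨F.quotient φ hcol' hadj', spasm_trans hF (quotient_mem_spasm φ hcol' hadj'), ?_,
    Set.rangeFactorization φ, Subtype.ext (by simp [φ]), fun x y h => ⟨x, y, h, rfl, rfl⟩, hcol',
    fun x y h => hinj x y (congrArg Subtype.val h)⟩
  have h1 : (Set.range φ).ncard < (Set.univ : Set F.V).ncard := by
    refine Set.ncard_lt_ncard ⟨Set.subset_univ _, fun h => ?_⟩ (Set.toFinite _)
    obtain ⟨x, hx⟩ := h (Set.mem_univ v)
    by_cases hxv : x = v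
    · simp only [φ, hxv, if_true] at hx
      exact huv hx
    · simp only [φ, hxv, if_false] at hx
  rwa [Set.ncard_univ, ← Nat.card_coe_set_eq] at h1

theorem exists_minimal_card (P : ColoredGraph.{u, v} C → Prop) (h : ∃ F ∈ H.spasm, P F) :
    ∃ F ∈ H.spasm, P F ∧ ∀ K ∈ H.spasm, P K → Nat.card F.V ≤ Nat.card K.V := by
  classical
  have hex : ∃ n, ∃ F ∈ H.spasm, P F ∧ Nat.card F.V = n := by
    obtain ⟨F, hF, hP⟩ := h
    exact ⟨_, F, hF, hP, rfl⟩
  obtain ⟨F, hF, hP, hn⟩ := Nat.find_spec hex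
  exact ⟨F, hF, hP, fun K hK hK' => hn ▸ Nat.find_min' hex ⟨K, hK, hK', rfl⟩⟩

/-- The graph `Ĥ` is a minor of a graph in the spasm whose color classes are cliques. -/
theorem treewidthAtMost_contraction {c : ℕ} (h : ∀ F ∈ H.spasm, TreewidthAtMost F.graph c) :
    TreewidthAtMost H.contraction c := by
  obtain ⟨F, hF, -, hmin⟩ := exists_minimal_card (H := H) (fun _ => True)
    ⟨H, H.self_mem_spasm, trivial⟩
  -- In a member of the spasm with fewest vertices no merge is possible.
  have hclique : ∀ i, F.graph.IsClique {x | F.color x = i} := by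
    intro i x hx y hy hne
    by_contra hadj
    obtain ⟨K, hK, hlt, -⟩ := exists_merge hF hne (hx.trans hy.symm) hadj
    exact absurd (hmin K hK trivial) (by omega)
  obtain ⟨D, hD⟩ := h F hF
  obtain ⟨f, -, -, hcol⟩ := hF
  refine ⟨⟨D.Node, D.finite_node, D.tree, D.isTree,
    fun t => {i | ∃ x ∈ {x | F.color x = i}, x ∈ D.bag t}, ?_, ?_⟩, fun t => ?_⟩
  · rintro ⟨_, x, rfl⟩
    exact D.connected_of_isClique ⟨f x, hcol x⟩ (hclique _)
  · rintro i j ⟨-, x, y, hxy, hx, hy⟩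
    obtain ⟨t, h1, h2⟩ := D.bag_edge _ _ (f.map_rel hxy)
    exact ⟨t, ⟨f x, (hcol x).trans hx, h1⟩, f y, (hcol y).trans hy, h2⟩
  · rw [← Subtype.val_injective.encard_image]
    refine (Set.encard_le_encard (t := F.color '' D.bag t) ?_).trans
      ((Set.encard_image_le _ _).trans (hD t))
    rintro _ ⟨i, ⟨x, hx, hxt⟩, rfl⟩
    exact ⟨x, hxt, hx⟩

theorem hasFlower_iff {c : ℕ} {i : C} :
    H.HasFlower c i ↔ HasPacking (H.cliqueGraphExcept i) {x | H.color x = i} c := by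
  constructor
  · rintro ⟨a, b, p, hp, hd⟩
    refine ⟨a, b, fun j => {v | v ∈ (p j).support},
      fun j => ⟨(hp j).2.2.1, (hp j).2.2.2, fun hab => ?_, .of_walk (p j) fun v hv => hv⟩,
      fun j k hjk => Set.disjoint_left.2 fun v h1 h2 => hd j k hjk h1 h2⟩
    have h1 := (hp j).1
    have h2 := (hp j).2.1
    revert h1 h2
    generalize p j = q
    revert q
    rw [hab]
    intro q h1 h2
    rw [SimpleGraph.Walk.isPath_iff_nil, ← SimpleGraph.Walk.length_eq_zero_iff] at h1
    omega
  · intro h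
    obtain ⟨a, b, p, hp, hd⟩ := h.exists_paths
    refine ⟨a, b, p, fun j => ⟨(hp j).2.2.2, ?_, (hp j).1, (hp j).2.1⟩, hd⟩
    rw [Nat.one_le_iff_ne_zero]
    exact fun h => (hp j).2.2.1 (SimpleGraph.Walk.eq_of_length_eq_zero h)

/-- A flower of `H` gives a graph in the spasm with a flower that uses only edges of the graph. -/
theorem exists_spasm_hasPacking {n : ℕ} {i : C} (h : H.HasFlower n i) :
    ∃ F ∈ H.spasm, HasPacking F.graph {x | F.color x = i} n := by
  obtain ⟨F, hF, hP, hmin⟩ := exists_minimal_card (H := H)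
    (fun F => HasPacking (F.cliqueGraphExcept i) {x | F.color x = i} n)
    ⟨H, H.self_mem_spasm, hasFlower_iff.1 h⟩
  refine ⟨F, hF, ?_⟩
  obtain ⟨a, b, p, hp, hd⟩ := hP.exists_paths
  have hreal : ∀ j, ∀ e ∈ (p j).edges, e ∈ F.graph.edgeSet := by
    intro j e he
    induction e with
    | _ u v =>
    by_contra hadj
    rw [SimpleGraph.mem_edgeSet] at hadj
    obtain ⟨huv, h1⟩ := (p j).adj_of_mem_edges he
    obtain ⟨hcol, hi⟩ := h1.resolve_left hadj
    have hu := (p j).fst_mem_support_of_mem_edges he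
    have hv := (p j).snd_mem_support_of_mem_edges he
    -- An edge of a petal that is missing in `F` joins vertices of one color other than `i`. Merging
    -- them only shortens this petal: ends have color `i` and stay distinct, and no other petal
    -- contains the merged vertices. This contradicts minimality.
    obtain ⟨K, hK, hlt, π, hπuv, hπadj, hπcol, hπ⟩ := exists_merge hF huv hcol hadj
    refine absurd (hmin K hK ⟨π ∘ a, π ∘ b, fun l => π '' {x | x ∈ (p l).support}, ?_, ?_⟩)
      (by omega)
    · intro l
      refine ⟨(hπcol _).trans (hp l).1, (hπcol _).trans (hp l).2.1, fun heq => ?_, ?_⟩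
      · rcases hπ _ _ heq with h | ⟨h, -⟩ | ⟨h, -⟩
        · exact (hp l).2.2.1 h
        · exact hi (by rw [← h]; exact (hp l).1)
        · exact hi (by rw [hcol, ← h]; exact (hp l).1)
      · refine ReachIn.map π ?_ (fun x hx => ⟨x, hx, rfl⟩) (.of_walk (p l) fun v hv => hv)
        rintro x - y - ⟨hxy, h | ⟨h, h'⟩⟩
        · exact Or.inr ⟨(hπadj x y h).ne, Or.inl (hπadj x y h)⟩
        · by_cases heq : π x = π y
          · exact Or.inl heq
          · exact Or.inr ⟨heq, Or.inr ⟨by rw [hπcol, hπcol, h], by rwa [hπcol]⟩⟩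
    · intro l l' hll
      refine Set.disjoint_left.2 ?_
      rintro _ ⟨x, hx, rfl⟩ ⟨y, hy, hxy⟩
      have hx' : x ∈ (p l).support := hx
      have hy' : y ∈ (p l').support := hy
      rcases hπ _ _ hxy with rfl | ⟨rfl, rfl⟩ | ⟨rfl, rfl⟩
      · exact hd l l' hll hx' hy'
      all_goals
        by_cases hlj : l = j
        · subst hlj
          first
            | exact hd l l' hll hu hy'
            | exact hd l l' hll hv hy'
        · first
            | exact hd l j hlj hx' hu
            | exact hd l j hlj hx' hv
  refine ⟨a, b, fun j => {x | x ∈ (p j).support}, fun j => ⟨(hp j).1, (hp j).2.1, (hp j).2.2.1,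
    .of_walk ((p j).transfer F.graph (hreal j)) fun v hv => by simpa using hv⟩, fun j l hjl => ?_⟩
  exact Set.disjoint_left.2 fun v h1 h2 => hd j l hjl h1 h2

end ColoredGraph

/-! ### Large flowers force clique minors in the spasm. -/

theorem ReachIn.exists_pred {V : Type*} {G : SimpleGraph V} {S : Set V} {x y : V}
    (h : ReachIn G S x y) (hne : x ≠ y) : ∃ z ∈ S, G.Adj z y := by
  cases h with
  | refl _ => exact absurd rfl hne
  | tail h hadj _ => exact ⟨_, h.right_mem, hadj⟩

/-- In a packing, the connections can be chosen such that each remains connected when its second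
end is removed. -/
theorem HasPacking.exists_removable {V : Type*} {G : SimpleGraph V} {A : Set V} {n : ℕ}
    (h : HasPacking G A n) : ∃ (a b : Fin n → V) (D : Fin n → Set V),
      (∀ j, a j ∈ A ∧ b j ∈ A ∧ a j ≠ b j ∧ a j ∈ D j ∧ b j ∈ D j ∧
        (∀ v ∈ D j, v ≠ b j → ReachIn G (D j \ {b j}) (a j) v) ∧
        ∃ z ∈ D j, G.Adj z (b j)) ∧ Pairwise (Function.onFun Disjoint D) := by
  obtain ⟨a, b, D, h, hD⟩ := h
  choose b' hb' D' hD' h1 h2 h3 using fun j => (h j).2.2.2.first_hit (B := {b j}) rfl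
  simp only [Set.mem_singleton_iff] at hb'
  obtain rfl : b' = b := funext hb'
  exact ⟨a, b', D', fun j => ⟨(h j).1, (h j).2.1, (h j).2.2.1, (h1 j).left_mem, (h1 j).right_mem,
    h3 j, (h1 j).exists_pred (h j).2.2.1⟩, fun i j hij => (hD hij).mono (hD' i) (hD' j)⟩

namespace ColoredGraph

variable {C : Type v} {H F : ColoredGraph.{u, v} C}

/-- A `k × k` array of disjoint connections whose first ends are independent and whose second ends
are independent has a quotient of treewidth at least `k - 1`. -/
theorem le_of_grid {c k : ℕ} [NeZero k] {i : C}
    (htw : ∀ K ∈ F.spasm, TreewidthAtMost K.graph c)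
    (a b : Fin k × Fin k → F.V) (D : Fin k × Fin k → Set F.V)
    (hab : ∀ q, F.color (a q) = i ∧ F.color (b q) = i ∧ a q ≠ b q ∧ a q ∈ D q ∧ b q ∈ D q ∧
        (∀ v ∈ D q, v ≠ b q → ReachIn F.graph (D q \ {b q}) (a q) v) ∧
        ∃ z ∈ D q, F.graph.Adj z (b q))
    (hD : Pairwise (Function.onFun Disjoint D))
    (ha : ∀ q q', ¬ F.graph.Adj (a q) (a q')) (hb : ∀ q q', ¬ F.graph.Adj (b q) (b q')) :
    k ≤ c + 1 := by
  classical
  have huniq : ∀ {q q' v}, v ∈ D q → v ∈ D q' → q = q' := by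
    intro q q' v h h'
    by_contra hne
    exact Set.disjoint_left.1 (hD hne) h h'
  have hainj : ∀ {q q'}, a q = a q' → q = q' := fun {q q'} h =>
    huniq (hab q).2.2.2.1 (h ▸ (hab q').2.2.2.1)
  have hbinj : ∀ {q q'}, b q = b q' → q = q' := fun {q q'} h =>
    huniq (hab q).2.2.2.2.1 (h ▸ (hab q').2.2.2.2.1)
  have habne : ∀ {q q'}, a q ≠ b q' := by
    intro q q' h
    have : q = q' := huniq (hab q).2.2.2.1 (h ▸ (hab q').2.2.2.2.1)
    subst this
    exact (hab q).2.2.1 h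
  -- First ends are identified along each row `m`, with representative `a (m, 0)`, and second ends
  -- along each column `l`, with representative `b (0, l)`.
  let φ : F.V → F.V := fun v =>
    if h : ∃ q, a q = v then a (h.choose.1, 0)
    else if h : ∃ q, b q = v then b (0, h.choose.2) else v
  have hφa : ∀ q, φ (a q) = a (q.1, 0) := by
    intro q
    have h : ∃ q', a q' = a q := ⟨q, rfl⟩
    simp only [φ, dif_pos h]
    rw [hainj h.choose_spec]
  have hφb : ∀ q, φ (b q) = b (0, q.2) := by
    intro q
    have h : ∃ q', b q' = b q := ⟨q, rfl⟩
    have h' : ¬ ∃ q', a q' = b q := fun ⟨q', h⟩ => habne h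
    simp only [φ, dif_neg h', dif_pos h]
    rw [hbinj h.choose_spec]
  have hφo : ∀ v, (∀ q, a q ≠ v) → (∀ q, b q ≠ v) → φ v = v := by
    intro v h1 h2
    have h1' : ¬ ∃ q', a q' = v := fun ⟨q', h⟩ => h1 q' h
    have h2' : ¬ ∃ q', b q' = v := fun ⟨q', h⟩ => h2 q' h
    simp only [φ, dif_neg h1', dif_neg h2']
  have hcases : ∀ v, (∃ q, v = a q) ∨ (∃ q, v = b q) ∨ φ v = v ∧ (∀ q, a q ≠ v) ∧ ∀ q, b q ≠ v := by
    intro v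
    by_cases h1 : ∃ q, v = a q
    · exact Or.inl h1
    by_cases h2 : ∃ q, v = b q
    · exact Or.inr (Or.inl h2)
    have h1' : ∀ q, a q ≠ v := fun q h => h1 ⟨q, h.symm⟩
    have h2' : ∀ q, b q ≠ v := fun q h => h2 ⟨q, h.symm⟩
    exact Or.inr (Or.inr ⟨hφo v h1' h2', h1', h2'⟩)
  have hidem : ∀ v, φ (φ v) = φ v := by
    intro v
    rcases hcases v with ⟨q, rfl⟩ | ⟨q, rfl⟩ | ⟨h, -⟩
    · rw [hφa, hφa]
    · rw [hφb, hφb]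
    · rw [h, h]
  have hcol : ∀ v, F.color (φ v) = F.color v := by
    intro v
    rcases hcases v with ⟨q, rfl⟩ | ⟨q, rfl⟩ | ⟨h, -⟩
    · rw [hφa, (hab _).1, (hab _).1]
    · rw [hφb, (hab _).2.1, (hab _).2.1]
    · rw [h]
  have hadj : ∀ u v, F.graph.Adj u v → φ u ≠ φ v := by
    intro u v huv heq
    rcases hcases u with ⟨q, rfl⟩ | ⟨q, rfl⟩ | ⟨h1, h2, h3⟩ <;>
      rcases hcases v with ⟨q', rfl⟩ | ⟨q', rfl⟩ | ⟨h1', h2', h3'⟩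
    · exact ha _ _ huv
    · rw [hφa, hφb] at heq
      exact habne heq
    · rw [hφa, h1'] at heq
      exact h2' _ heq
    · rw [hφa, hφb] at heq
      exact habne heq.symm
    · exact hb _ _ huv
    · rw [hφb, h1'] at heq
      exact h3' _ heq
    · rw [hφa, h1] at heq
      exact h2 _ heq.symm
    · rw [hφb, h1] at heq
      exact h3 _ heq.symm
    · exact huv.ne (h1.symm.trans (heq.trans h1'))
  -- Branch set `m`: the connections of row `m` without their second ends, which hang together at
  -- the merged first end, and the merged second end of column `m`, attached through the diagonal
  -- entry `(m, m)`. Entry `(m, l)` makes branch sets `m` and `l` touch.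
  let L : Fin k → F.V → Prop := fun m v =>
    (∃ l, v ∈ D (m, l) ∧ v ≠ b (m, l)) ∨ ∃ m', v = b (m', m)
  have hLuniq : ∀ {m m' v}, L m v → L m' v → m = m' := by
    rintro m m' v (⟨l, h1, h2⟩ | ⟨n, rfl⟩) (⟨l', h1', h2'⟩ | ⟨n', h⟩)
    · exact congrArg Prod.fst (huniq h1 h1')
    · have := huniq h1 (h ▸ (hab (n', m')).2.2.2.2.1)
      exact absurd (this ▸ h) h2
    · have := huniq h1' ((hab (n, m)).2.2.2.2.1)
      exact absurd (this ▸ rfl) h2'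
    · exact congrArg Prod.snd (hbinj h)
  have hLφ : ∀ {m v}, L m v → L m (φ v) := by
    rintro m v (⟨l, h1, h2⟩ | ⟨n, rfl⟩)
    · rcases hcases v with ⟨q, rfl⟩ | ⟨q, rfl⟩ | ⟨h, -⟩
      · obtain rfl := huniq (hab q).2.2.2.1 h1
        rw [hφa]
        exact Or.inl ⟨0, (hab _).2.2.2.1, habne⟩
      · obtain rfl := huniq (hab q).2.2.2.2.1 h1
        exact absurd rfl h2
      · rw [h]
        exact Or.inl ⟨l, h1, h2⟩
    · rw [hφb]
      exact Or.inr ⟨0, rfl⟩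
  let π : F.V → Set.range φ := Set.rangeFactorization φ
  let Q := F.quotient φ hcol hadj
  have hπ : ∀ {u v}, φ u = φ v → π u = π v := fun h => Subtype.ext h
  have hreach : ∀ {m l v}, v ∈ D (m, l) → v ≠ b (m, l) →
      ReachIn Q.graph {w : Set.range φ | L m w} (π (a (m, 0))) (π v) := by
    intro m l v h1 h2
    have h3 : π (a (m, 0)) = π (a (m, l)) := hπ (by rw [hφa, hφa])
    rw [h3]
    refine ReachIn.map π (fun x _ y _ h => Or.inr ⟨x, y, h, rfl, rfl⟩) ?_
      ((hab (m, l)).2.2.2.2.2.1 v h1 h2)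
    rintro w ⟨h4, h5⟩
    exact hLφ (Or.inl ⟨l, h4, h5⟩)
  refine card_le_of_touching (htw Q (quotient_mem_spasm φ hcol hadj)) (fun m => {w | L m w.1})
    (fun m => π (a (m, 0))) (fun m => hLφ (Or.inl ⟨0, (hab _).2.2.2.1, habne⟩)) ?_ ?_ ?_
  · rintro m ⟨_, v, rfl⟩ hw
    have h0 : (⟨φ v, v, rfl⟩ : Set.range φ) = π (φ v) := Subtype.ext (hidem v).symm
    rw [h0]
    rcases hw with ⟨l, h1, h2⟩ | ⟨n, h⟩
    · exact hreach h1 h2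
    · obtain ⟨z, hz, hzb⟩ := (hab (m, m)).2.2.2.2.2.2
      have h3 : π (φ v) = π (b (m, m)) := by
        have h3 : φ v = b (n, m) := h
        exact hπ (by rw [h3, hφb, hφb])
      rw [h3]
      exact (hreach hz hzb.ne).tail ⟨z, _, hzb, rfl, rfl⟩ (hLφ (Or.inr ⟨m, rfl⟩))
  · intro m m' hne
    exact Set.disjoint_left.2 fun w h h' => hne (hLuniq h h')
  · intro m l hne
    obtain ⟨z, hz, hzb⟩ := (hab (m, l)).2.2.2.2.2.2
    exact ⟨π z, hLφ (Or.inl ⟨l, hz, hzb.ne⟩), π (b (m, l)), hLφ (Or.inr ⟨m, rfl⟩), z, _, hzb, rfl,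
      rfl⟩

/-- A flower with this many petals yields a graph of treewidth more than `c` in the spasm. -/
def flowerBound (c : ℕ) : ℕ := (c + 1) * (c + 1) * ((c + 2) * (c + 2)) + 1

theorem not_hasFlower_of_treewidth {c : ℕ} (htw : ∀ F ∈ H.spasm, TreewidthAtMost F.graph c)
    (i : C) : ¬ H.HasFlower (flowerBound c) i := by
  intro h
  obtain ⟨F, hF, hP⟩ := exists_spasm_hasPacking h
  have := F.finite_V
  obtain ⟨a, b, D, hab, hD⟩ := hP.exists_removable
  obtain ⟨χ, hχ⟩ := (htw F hF).exists_coloring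
  -- Among the `(c + 1) * (c + 1)` color pairs of the ends, one occurs on more than `(c + 2) * (c +
  -- 2)` petals. Equal colors under `χ` make the first ends independent, and likewise the second
  -- ends; side length `c + 2` then contradicts `le_of_grid`.
  obtain ⟨q, hq⟩ := Fintype.exists_lt_card_fiber_of_mul_lt_card
    (f := fun j => (χ (a j), χ (b j))) (n := (c + 2) * (c + 2)) (by
      rw [Fintype.card_prod, Fintype.card_fin, Fintype.card_fin]
      exact Nat.lt_succ_self _)
  set Φ := Finset.univ.filter fun j => (χ (a j), χ (b j)) = q with hΦ
  have hemb : Nonempty (Fin (c + 2) × Fin (c + 2) ↪ Φ) :=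
    Function.Embedding.nonempty_of_card_le (by simpa using hq.le)
  obtain ⟨e⟩ := hemb
  have he : ∀ p, (χ (a (e p)), χ (b (e p))) = q := fun p => (Finset.mem_filter.1 (e p).2).2
  have hle := le_of_grid (F := F) (i := i) (k := c + 2) (c := c)
    (fun K hK => htw K (spasm_trans hF hK)) (fun p => a (e p)) (fun p => b (e p))
    (fun p => D (e p)) (fun p => hab (e p))
    (fun p p' hne => hD fun h => hne (e.injective (Subtype.ext h)))
    (fun p p' hadj => hχ _ _ hadj (congrArg Prod.fst ((he p).trans (he p').symm)))
    (fun p p' hadj => hχ _ _ hadj (congrArg Prod.snd ((he p).trans (he p').symm)))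
  omega

end ColoredGraph

/-! ### Hitting sets that are near their color in the tree decomposition. -/

/-- Two disjoint subtrees `A` and `B` are separated by a node of `A`. -/
theorem ParentTree.exists_separating_node {N : Type*} {R : ParentTree N} {A B : Set N} {α β : N}
    (hA : R.IsSubtree A α) (hB : R.IsSubtree B β) (hAB : Disjoint A B) :
    ∃ t ∈ A, ∃ U : Set N, B ⊆ U ∧ Disjoint A U ∧
      ∀ S σ, R.IsSubtree S σ → (∃ s ∈ S, s ∈ U) → (∃ s ∈ S, s ∉ U) → t ∈ S := by
  by_cases h : R.Anc α β
  -- Going up from `β`, the walk enters `A` through some `u` with parent in `A`. That parent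
  -- separates, and `U` consists of the descendants of `u`.
  · have key : ∀ {γ}, R.Anc α γ → γ ∉ A →
        ∃ u, R.Anc u γ ∧ u ∉ A ∧ u ≠ R.root ∧ R.parent u ∈ A := by
      intro γ hγ
      induction hγ with
      | refl => exact fun h => absurd hA.1 h
      | @child s hs _ ih =>
        intro hsA
        by_cases hp : R.parent s ∈ A
        · exact ⟨s, .refl, hsA, hs, hp⟩
        · obtain ⟨u, h1, h2⟩ := ih hp
          exact ⟨u, .child hs h1, h2⟩
    obtain ⟨u, hu, huA, hur, hup⟩ := key h (Set.disjoint_right.1 hAB hB.1)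
    have hdu := R.depth_eq u hur
    have hαu := (hA.anc hup).depth_le
    refine ⟨R.parent u, hup, {s | R.Anc u s}, fun s hs => hu.trans (hB.anc hs), ?_, ?_⟩
    · refine Set.disjoint_left.2 fun s hs hus => huA (hA.mem_of_anc hs hus ?_)
      omega
    · rintro S σ hS ⟨s, hs, hsU⟩ ⟨s', hs', hsU'⟩
      refine hS.mem_of_anc hs ((ParentTree.anc_parent hur).trans hsU) ?_
      by_contra hcon
      exact hsU' ((ParentTree.Anc.of_depth_le hsU (hS.anc hs) (by omega)).trans (hS.anc hs'))
  · refine ⟨α, hA.1, {s | ¬ R.Anc α s}, fun s hs hαs => ?_,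
      Set.disjoint_left.2 fun s hs hs' => hs' (hA.anc hs), ?_⟩
    · rcases le_total (R.depth α) (R.depth β) with hd | hd
      · exact h (hαs.of_depth_le (hB.anc hs) hd)
      · exact Set.disjoint_left.1 hAB hA.1 (hB.mem_of_anc hs hαs hd)
    · rintro S σ hS ⟨s, hs, hsU⟩ ⟨s', hs', hsU'⟩
      simp only [Set.mem_ofPred_eq, not_not] at hsU'
      rcases le_total (R.depth σ) (R.depth α) with hd | hd
      · exact hS.mem_of_anc hs' hsU' hd
      · exact absurd ((hsU'.of_depth_le (hS.anc hs') hd).trans (hS.anc hs)) hsU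

theorem ncard_biUnion_le_mul {α β : Type*} [Finite β] {s : Set α} (hs : s.Finite) (f : α → Set β)
    {m : ℕ} (h : ∀ a ∈ s, (f a).ncard ≤ m) : (⋃ a ∈ s, f a).ncard ≤ s.ncard * m := by
  induction s, hs using Set.Finite.induction_on with
  | empty => simp
  | @insert a s ha hs ih =>
    rw [Set.biUnion_insert, Set.ncard_insert_of_notMem ha hs]
    have h1 := Set.ncard_union_le (f a) (⋃ b ∈ s, f b)
    have h2 := ih fun b hb => h b (Or.inr hb)
    have h3 := h a (Or.inl rfl)
    rw [Nat.add_mul]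
    omega

namespace ColoredGraph

variable {C : Type v} {H : ColoredGraph.{u, v} C}

/-- A rooted tree decomposition of `Ĥ`, together with, for each color `i`, a set hitting all
paths between two vertices of color `i`, whose vertices have colors sharing a bag with `i`. -/
structure HittingSystem (H : ColoredGraph.{u, v} C) (N : Type w) where
  R : ParentTree N
  cols : N → Set C
  hit : C → Set H.V
  exists_color : ∀ t, ∀ i ∈ cols t, ∃ v, H.color v = i
  cols_subtree : ∀ v, ∃ τ, R.IsSubtree {t | H.color v ∈ cols t} τ
  cols_adj : ∀ x y, H.graph.Adj x y → ∃ t, H.color x ∈ cols t ∧ H.color y ∈ cols t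
  hit_near : ∀ i, ∀ v ∈ hit i, ∃ t, i ∈ cols t ∧ H.color v ∈ cols t
  hit_sep : ∀ a b, H.color a = H.color b → a ≠ b →
    ¬ ReachIn (H.cliqueGraphExcept (H.color a)) (hit (H.color a))ᶜ a b

theorem reachIn_of_color_eq {i : C} {S : Set H.V} {x y : H.V} (hx : x ∈ S) (hy : y ∈ S)
    (hxy : H.color x = H.color y) (hi : H.color x ≠ i) :
    ReachIn (H.cliqueGraphExcept i) S x y := by
  by_cases h : x = y
  · subst h; exact .refl hx
  · exact (ReachIn.refl hx).tail ⟨h, Or.inr ⟨hxy, hi⟩⟩ hy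

/-- The hitting set for color `i` can be chosen close to `i` in the tree decomposition. -/
theorem exists_near_hitting {N : Type w} (R : ParentTree N) (cols : N → Set C) {c m : ℕ}
    (hsub : ∀ v, ∃ τ, R.IsSubtree {t | H.color v ∈ cols t} τ)
    (hadj : ∀ x y, H.graph.Adj x y → ∃ t, H.color x ∈ cols t ∧ H.color y ∈ cols t)
    (hfin : ∀ t, (cols t).Finite) (hcard : ∀ t, (cols t).ncard ≤ c) (v₀ : H.V) {X : Set H.V}
    (hX : X.ncard ≤ m)
    (hsep : ∀ a b, H.color a = H.color v₀ → H.color b = H.color v₀ → a ≠ b →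
      ¬ ReachIn (H.cliqueGraphExcept (H.color v₀)) Xᶜ a b) :
    ∃ Y : Set H.V, Y.ncard ≤ m + m * c ∧
      (∀ v ∈ Y, ∃ t, H.color v₀ ∈ cols t ∧ H.color v ∈ cols t) ∧
      ∀ a b, H.color a = H.color v₀ → H.color b = H.color v₀ → a ≠ b →
        ¬ ReachIn (H.cliqueGraphExcept (H.color v₀)) Yᶜ a b := by
  classical
  have := H.finite_V
  set i := H.color v₀ with hi
  obtain ⟨α, hα⟩ := hsub v₀
  rw [← hi] at hα
  let near : H.V → Prop := fun v => ∃ t, i ∈ cols t ∧ H.color v ∈ cols t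
  -- A far vertex `v` of `X` is replaced by the vertices of color `i` that reach a neighbor of `v`
  -- without meeting `X`.
  let Rv : H.V → Set H.V := fun v => {x | H.color x = i ∧ ¬ near v ∧
    ∃ y, (H.cliqueGraphExcept i).Adj y v ∧ ReachIn (H.cliqueGraphExcept i) Xᶜ x y}
  have hnear : ∀ x, H.color x = i → near x := fun x hx => ⟨α, hα.1, by rw [hx]; exact hα.1⟩
  have hRv : ∀ v, (Rv v).ncard ≤ c := by
    intro v
    by_cases hv : near v
    · have : Rv v = ∅ := Set.eq_empty_of_forall_notMem fun x hx => hx.2.1 hv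
      rw [this]
      simp
    obtain ⟨β, hβ⟩ := hsub v
    obtain ⟨t, ht, U, hBU, hAU, hU⟩ := ParentTree.exists_separating_node hα hβ
      (Set.disjoint_left.2 fun s hs hs' => hv ⟨s, hs, hs'⟩)
    have hstep : ∀ w w', (H.cliqueGraphExcept i).Adj w w' → Disjoint {s | H.color w ∈ cols s} U →
        (H.color w' ≠ i ∧ H.color w' ∈ cols t) ∨ Disjoint {s | H.color w' ∈ cols s} U := by
      rintro w w' ⟨-, h | ⟨h, -⟩⟩ hd
      · by_cases hd' : Disjoint {s | H.color w' ∈ cols s} U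
        · exact Or.inr hd'
        obtain ⟨s, hs, hsU⟩ := Set.not_disjoint_iff.1 hd'
        obtain ⟨r, hr, hr'⟩ := hadj w w' h
        obtain ⟨τ, hτ⟩ := hsub w'
        refine Or.inl ⟨fun heq => hd' (by rw [heq]; exact hAU), hU _ τ hτ ⟨s, hs, hsU⟩ ⟨r, hr', ?_⟩⟩
        exact Set.disjoint_left.1 hd hr
      · rw [h] at hd
        exact Or.inr hd
    -- On the way from color `i` to `v`, a walk must pass a vertex with another color of the
    -- separating node `t`. Two starting vertices cannot arrive at the same such color, since its
    -- class is a clique and would join them outside `X`; hence `Rv v` has at most `c` elements.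
    have hz : ∀ x ∈ Rv v, ∃ z, H.color z ≠ i ∧ H.color z ∈ cols t ∧
        ReachIn (H.cliqueGraphExcept i) Xᶜ x z := by
      rintro x ⟨hx, -, y, hyv, hxy⟩
      have key : ∀ {w}, ReachIn (H.cliqueGraphExcept i) Xᶜ x w →
          (∃ z, H.color z ≠ i ∧ H.color z ∈ cols t ∧ ReachIn (H.cliqueGraphExcept i) Xᶜ x z) ∨
            Disjoint {s | H.color w ∈ cols s} U := by
        intro w hw
        induction hw with
        | refl h => exact Or.inr (by rw [hx]; exact hAU)
        | @tail w w' h hadj' hw' ih =>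
          rcases ih with ih | ih
          · exact Or.inl ih
          rcases hstep w w' hadj' ih with h1 | h1
          · exact Or.inl ⟨w', h1.1, h1.2, h.tail hadj' hw'⟩
          · exact Or.inr h1
      rcases key hxy with h | h
      · exact h
      rcases hstep y v hyv h with h1 | h1
      · exact absurd ⟨t, ht, h1.2⟩ hv
      · exact absurd (hBU hβ.1) (Set.disjoint_left.1 h1 hβ.1)
    choose! z hz1 hz2 hz3 using hz
    refine le_trans ?_ (hcard t)
    refine Set.ncard_le_ncard_of_injOn (fun x => H.color (z x)) hz2 ?_ (hfin t)
    intro x hx x' hx' heq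
    by_contra hne
    refine hsep x x' hx.1 hx'.1 hne (((hz3 x hx).trans ?_).trans (hz3 x' hx').symm)
    exact reachIn_of_color_eq (hz3 x hx).right_mem (hz3 x' hx').right_mem heq (hz1 x hx)
  refine ⟨{v | v ∈ X ∧ near v} ∪ ⋃ v ∈ X, Rv v, ?_, ?_, ?_⟩
  · refine (Set.ncard_union_le _ _).trans (add_le_add ?_ ?_)
    · exact (Set.ncard_le_ncard (fun v hv => hv.1) (Set.toFinite X)).trans hX
    · refine (ncard_biUnion_le_mul (Set.toFinite X) Rv fun v _ => hRv v).trans ?_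
      gcongr
  · rintro v (hv | hv)
    · exact hv.2
    · simp only [Set.mem_iUnion] at hv
      obtain ⟨w, -, hw⟩ := hv
      exact hnear v hw.1
  · intro a b ha hb hab hr
    have haY := hr.left_mem
    -- At the first vertex of `X` on a walk from `a`, either this vertex is near and belongs to the
    -- new set, or it is far and then `a` itself belongs to the new set.
    have key : ∀ {w}, ReachIn (H.cliqueGraphExcept i)
        ({v | v ∈ X ∧ near v} ∪ ⋃ v ∈ X, Rv v)ᶜ a w → ReachIn (H.cliqueGraphExcept i) Xᶜ a w := by
      intro w hw
      induction hw with
      | refl h => exact .refl fun haX => h (Or.inl ⟨haX, hnear a ha⟩)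
      | @tail w w' h hadj' hw' ih =>
        refine ih.tail hadj' fun hX' => ?_
        by_cases hn : near w'
        · exact hw' (Or.inl ⟨hX', hn⟩)
        · refine haY (Or.inr ?_)
          simp only [Set.mem_iUnion]
          exact ⟨w', hX', ha, hn, w, hadj', ih⟩
    exact hsep a b ha hb hab (key hr)

/-- The size of the hitting sets of a color. -/
def nearHittingBound (c : ℕ) : ℕ := hittingBound c + hittingBound c * (c + 1)

/-- Bags of `contraction` have up to `c + 1` colors, whence the factor `c + 1` in
`nearHittingBound`. Colors that do not occur get the empty hitting set. -/
theorem exists_hittingSystem {c : ℕ} (htw : TreewidthAtMost H.contraction c)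
    (hfl : ∀ i, ¬ H.HasFlower c i) :
    ∃ (N : Type) (_ : Finite N) (S : H.HittingSystem N),
      (∀ t, (S.cols t).encard ≤ (c + 1 : ℕ)) ∧ ∀ i, (S.hit i).ncard ≤ nearHittingBound c := by
  classical
  have := H.finite_V
  obtain ⟨D, hD⟩ := htw
  obtain ⟨r⟩ := D.nonempty_node
  obtain ⟨R, -, -, top, htop⟩ := D.exists_rooted r
  let cols : D.Node → Set C := fun t => Subtype.val '' D.bag t
  have hmem : ∀ v t, H.color v ∈ cols t ↔ (⟨H.color v, v, rfl⟩ : Set.range H.color) ∈ D.bag t := by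
    intro v t
    constructor
    · rintro ⟨i, hi, h⟩
      have : i = ⟨H.color v, v, rfl⟩ := Subtype.ext h
      rwa [← this]
    · exact fun h => ⟨_, h, rfl⟩
  have hsub : ∀ v, ∃ τ, R.IsSubtree {t | H.color v ∈ cols t} τ := by
    intro v
    simp only [hmem]
    exact ⟨_, htop _⟩
  have hadj : ∀ x y, H.graph.Adj x y → ∃ t, H.color x ∈ cols t ∧ H.color y ∈ cols t := by
    intro x y h
    by_cases hxy : H.color x = H.color y
    · obtain ⟨τ, hτ⟩ := hsub x
      exact ⟨τ, hτ.1, by rw [← hxy]; exact hτ.1⟩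
    · simp only [hmem]
      exact D.bag_edge _ _ ⟨fun h' => hxy (congrArg Subtype.val h'), x, y, h, rfl, rfl⟩
  have hcols : ∀ t, (cols t).encard ≤ (c + 1 : ℕ) := fun t =>
    (Set.encard_image_le _ _).trans (by exact_mod_cast hD t)
  have hX : ∀ i, ∃ Y : Set H.V, Y.ncard ≤ nearHittingBound c ∧
      (∀ v ∈ Y, ∃ t, i ∈ cols t ∧ H.color v ∈ cols t) ∧
      ∀ a b, H.color a = i → H.color b = i → a ≠ b →
        ¬ ReachIn (H.cliqueGraphExcept i) Yᶜ a b := by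
    intro i
    by_cases hi : ∃ v, H.color v = i
    · obtain ⟨v₀, rfl⟩ := hi
      obtain ⟨X, hX1, hX2⟩ := exists_hitting_of_not_hasPacking _ _ c
        (fun h => hfl (H.color v₀) (hasFlower_iff.2 h))
      exact exists_near_hitting R cols hsub hadj
        (fun t => Set.finite_of_encard_le_coe (hcols t))
        (fun t => (Set.encard_le_coe_iff_finite_ncard_le.1 (hcols t)).2) v₀ hX1
        fun a b ha hb => hX2 a ha b hb
    · exact ⟨∅, by simp, by simp, fun a b ha => absurd ⟨a, ha⟩ hi⟩
  choose X hX1 hX2 hX3 using hX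
  refine ⟨D.Node, D.finite_node, ⟨R, cols, X, ?_, hsub, hadj, hX2, fun a b h => ?_⟩, hcols, hX1⟩
  · rintro t _ ⟨⟨_, v, rfl⟩, -, rfl⟩
    exact ⟨v, rfl⟩
  · exact hX3 _ a b rfl h.symm

end ColoredGraph

/-! ### Construction of the guarded cutvertex decomposition. -/

namespace ColoredGraph

variable {C : Type v} {H : ColoredGraph.{u, v} C}

/-- A guarded cutvertex decomposition from a rooted tree with bags and guards. -/
theorem exists_guarded_of_rooted {N : Type w} [Finite N] (R : ParentTree N)
    (bag guard : N → Set H.V) (hbag : ∀ x, ∃ τ, R.IsSubtree {t | x ∈ bag t} τ)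
    (hedge : ∀ x y, H.cliqueGraph.Adj x y → ∃ t, x ∈ bag t ∧ y ∈ bag t)
    (hsep : ∀ t, t ≠ R.root → ∀ x, x ∈ bag t → x ∈ bag (R.parent t) → x ∈ guard t)
    (hguard : ∀ t, guard t ⊆ bag t)
    (hcover : ∀ t x y, x ∈ bag t → y ∈ bag t → H.graph.Adj x y → x ∈ guard t ∨ y ∈ guard t)
    (hdiff : ∀ t, t ≠ R.root → ∀ x y, x ∈ bag t → x ∈ bag (R.parent t) →
      x ∉ guard (R.parent t) → y ∈ bag t → y ∈ bag (R.parent t) → y ∉ guard (R.parent t) → x = y)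
    {c : ℕ} (hsize : ∀ t, (guard t).encard ≤ c) (hcol : ∀ t, (H.color '' bag t).encard ≤ c) :
    ∃ D : H.GuardedCutvertexDecomposition, D.GuardSizeAtMost c ∧ D.BagColorsAtMost c := by
  let e := Finite.equivFin N
  have hch : ∀ {s t}, IsChild (R.map e).graph (R.map e).root s t →
      e.symm t ≠ R.root ∧ R.parent (e.symm t) = e.symm s := by
    intro s t h
    obtain ⟨h1, h2⟩ := ParentTree.isChild_iff.1 h
    refine ⟨fun h => h1 ?_, ?_⟩
    · rw [← e.apply_symm_apply t, h]
      rfl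
    · rw [← h2]
      exact (e.symm_apply_apply _).symm
  refine ⟨{ toTreeDecomposition := .ofRooted (R.map e) (fun t => bag (e.symm t)) (fun x => ?_)
              (fun x y h => ?_)
            root := (R.map e).root
            guard := fun t => guard (e.symm t)
            separator_subset_guard := ?_
            guard_subset_bag := fun t => hguard _
            guard_isVertexCover := ?_
            separator_diff_guard := ?_ }, fun t => hsize (e.symm t), fun t => hcol (e.symm t)⟩
  · obtain ⟨τ, h⟩ := hbag x
    exact ⟨e τ, h.map e⟩
  · obtain ⟨t, h⟩ := hedge x y h
    exact ⟨e t, by simpa using h⟩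
  · rintro t x ⟨s, hs, hx, hx'⟩
    obtain ⟨h1, h2⟩ := hch hs
    exact hsep _ h1 x hx (by rw [h2]; exact hx')
  · rintro t ⟨x, hx⟩ ⟨y, hy⟩ hadj
    exact hcover _ x y hx hy hadj
  · intro t t' htt
    obtain ⟨h1, h2⟩ := hch htt
    rw [Set.encard_le_one_iff]
    rintro x y ⟨⟨s, hs, hx, hx'⟩, hxg⟩ ⟨⟨s', hs', hy, hy'⟩, hyg⟩
    rw [← h2] at hxg hyg
    exact hdiff _ h1 x y hx (by rw [(hch hs).2]; exact hx') hxg hy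
      (by rw [(hch hs').2]; exact hy') hyg

namespace HittingSystem

variable {N : Type w} (S : H.HittingSystem N)

/-- The nodes whose colors, or whose hitting sets, involve `v`. -/
def nodes (v : H.V) : Set N := {t | H.color v ∈ S.cols t ∨ ∃ i ∈ S.cols t, v ∈ S.hit i}

/-- This is the purpose of `hit_near`: the subtree of each color whose hitting set contains `v`
meets the subtree of the color of `v`, so their union is connected. -/
theorem exists_nodes_subtree (v : H.V) : ∃ τ, S.R.IsSubtree (S.nodes v) τ := by
  apply ParentTree.exists_isSubtree
  obtain ⟨τ, hτ⟩ := S.cols_subtree v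
  have hcol : ∀ t, H.color v ∈ S.cols t → ReachIn S.R.graph (S.nodes v) τ t := fun t ht =>
    (hτ.reachIn ht).mono_set fun s hs => Or.inl hs
  refine ReachIn.connected_of (Or.inl hτ.1) fun t ht => ?_
  rcases ht with ht | ⟨i, hi, hv⟩
  · exact hcol t ht
  · obtain ⟨w, rfl⟩ := S.exists_color t i hi
    obtain ⟨s, hs, hs'⟩ := S.hit_near _ v hv
    obtain ⟨σ, hσ⟩ := S.cols_subtree w
    refine (hcol s hs').trans (((hσ.reachIn hs).symm.trans (hσ.reachIn hi)).mono_set ?_)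
    exact fun r hr => Or.inr ⟨_, hr, hv⟩

/-- The topmost node involving `v`. -/
noncomputable def top (v : H.V) : N := (S.exists_nodes_subtree v).choose

theorem top_spec (v : H.V) : S.R.IsSubtree (S.nodes v) (S.top v) :=
  (S.exists_nodes_subtree v).choose_spec

/-- The vertices that are involved only in nodes below `t`. -/
def below (t : N) : Set H.V := {v | S.R.Anc t (S.top v)}

/-- The component of `v` in the part of the graph below `t`. -/
def comp (t : N) (v : H.V) : Set H.V := {w | ReachIn H.cliqueGraph (S.below t) v w}

/-- The neighborhood above `t` of a set `K` of vertices below `t`. -/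
def boundary (t : N) (K : Set H.V) : Set H.V :=
  {x | x ∉ S.below t ∧ ∃ w ∈ K, H.cliqueGraph.Adj w x}

/-- The vertices in the hitting sets of the colors of `t`. -/
def hits (t : N) : Set H.V := ⋃ i ∈ S.cols t, S.hit i

/-- The vertices of a color of `t` that are connected to another color of `t`, avoiding the hitting
set of their color. -/
def special (t : N) : Set H.V :=
  {x | H.color x ∈ S.cols t ∧ ∃ y, H.color y ∈ S.cols t ∧ H.color y ≠ H.color x ∧
    ReachIn (H.cliqueGraphExcept (H.color x)) (S.hit (H.color x))ᶜ x y}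

variable {S} {t : N} {v w x y : H.V} {K : Set H.V}

theorem exists_common_node (h : H.cliqueGraph.Adj x y) : ∃ s, s ∈ S.nodes x ∧ s ∈ S.nodes y := by
  rcases h with ⟨-, h | h⟩
  · obtain ⟨s, h1, h2⟩ := S.cols_adj x y h
    exact ⟨s, Or.inl h1, Or.inl h2⟩
  · obtain ⟨τ, hτ⟩ := S.cols_subtree x
    exact ⟨τ, Or.inl hτ.1, Or.inl (by rw [← h]; exact hτ.1)⟩

theorem below_subset_parent (ht : t ≠ S.R.root) : S.below t ⊆ S.below (S.R.parent t) :=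
  fun _ hv => (ParentTree.anc_parent ht).trans hv

theorem mem_comp_self (h : v ∈ S.below t) : v ∈ S.comp t v := .refl h

theorem comp_eq (h : w ∈ S.comp t v) : S.comp t w = S.comp t v := by
  ext x
  exact ⟨fun hx => ReachIn.trans h hx, fun hx => (ReachIn.symm h).trans hx⟩

theorem comp_subset_below : S.comp t v ⊆ S.below t := fun _ h => h.right_mem

theorem comp_subset_parent (ht : t ≠ S.R.root) : S.comp t v ⊆ S.comp (S.R.parent t) v :=
  fun _ h => ReachIn.mono_set h (below_subset_parent ht)

theorem eq_top_of_mem (h : v ∈ S.below t) (ht : t ∈ S.nodes v) : t = S.top v :=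
  (ParentTree.Anc.eq_of_depth_le h ((S.top_spec v).anc ht).depth_le)

theorem not_mem_nodes_parent (h : v ∈ S.below t) (ht : t ≠ S.R.root) :
    S.R.parent t ∉ S.nodes v := by
  intro hp
  have h1 := ((S.top_spec v).anc hp).depth_le
  have h2 := ParentTree.Anc.depth_le h
  have h3 := S.R.depth_eq t ht
  omega

/-- The subtree of `x` shares a node below `t` with that of a neighbor in `K`, but its top is not
below `t`. So it passes through `t` and the parent of `t`. -/
theorem boundary_spec (hK : K ⊆ S.below t) (hx : x ∈ S.boundary t K) :
    t ≠ S.R.root ∧ S.R.parent t ∈ S.nodes x := by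
  obtain ⟨hxt, w, hw, hadj⟩ := hx
  obtain ⟨s, hsw, hsx⟩ := exists_common_node (S := S) hadj
  have hts : S.R.Anc t s := (hK hw : S.R.Anc t (S.top w)).trans ((S.top_spec w).anc hsw)
  have hxs := (S.top_spec x).anc hsx
  have hd : S.R.depth (S.top x) ≤ S.R.depth t := by
    by_contra hcon
    exact hxt (hts.of_depth_le hxs (by omega))
  refine (S.top_spec x).2 t ((S.top_spec x).mem_of_anc hsx hts hd) fun h => hxt ?_
  rw [below, Set.mem_ofPred_eq, ← h]
  exact .refl

theorem color_mem_of_notMem_hits (ht : t ∈ S.nodes x) (hx : x ∉ S.hits t) :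
    H.color x ∈ S.cols t ∧ ∀ i ∈ S.cols t, x ∉ S.hit i := by
  have h : ∀ i ∈ S.cols t, x ∉ S.hit i := fun i hi h => hx (Set.mem_biUnion hi h)
  refine ⟨ht.resolve_right ?_, h⟩
  rintro ⟨i, hi, hxi⟩
  exact h i hi hxi

theorem notMem_of_below (h : v ∈ S.below t) (ht : t ≠ S.R.root) :
    H.color v ∉ S.cols (S.R.parent t) ∧ ∀ i ∈ S.cols (S.R.parent t), v ∉ S.hit i := by
  have := not_mem_nodes_parent h ht
  exact ⟨fun h => this (Or.inl h), fun i hi hv => this (Or.inr ⟨i, hi, hv⟩)⟩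

/-- At most one vertex outside the hitting sets and the special vertices is attached to a
component. -/
theorem boundary_unique (hx : x ∈ S.boundary t (S.comp t v))
    (hy : y ∈ S.boundary t (S.comp t v))
    (hxg : x ∉ S.hits (S.R.parent t) ∪ S.special (S.R.parent t))
    (hyg : y ∉ S.hits (S.R.parent t) ∪ S.special (S.R.parent t)) : x = y := by
  by_contra hne
  obtain ⟨ht, hpx⟩ := boundary_spec comp_subset_below hx
  obtain ⟨-, hpy⟩ := boundary_spec comp_subset_below hy
  obtain ⟨hx1, hx2⟩ := color_mem_of_notMem_hits hpx fun h => hxg (Or.inl h)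
  obtain ⟨hy1, hy2⟩ := color_mem_of_notMem_hits hpy fun h => hyg (Or.inl h)
  set i := H.color x with hi
  obtain ⟨-, a, ha, hax⟩ := hx
  obtain ⟨-, b, hb, hby⟩ := hy
  -- Vertices below `t` have no color of the parent and lie in none of its hitting sets. So the
  -- component connects `x` to `y` in `cliqueGraphExcept i` outside `hit i`: equal colors contradict
  -- `hit_sep`, and different colors make `x` special.
  have hlift : ∀ u ∈ S.below t, ∀ z, H.cliqueGraph.Adj u z →
      (H.cliqueGraphExcept i).Adj u z := by
    rintro u hu z ⟨h1, h2 | h2⟩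
    · exact ⟨h1, Or.inl h2⟩
    · exact ⟨h1, Or.inr ⟨h2, fun h => (notMem_of_below hu ht).1 (h ▸ hx1)⟩⟩
  have hcomp : ReachIn H.cliqueGraph (S.below t) a b := (ReachIn.symm ha).trans hb
  have hab : ReachIn (H.cliqueGraphExcept i) (S.hit i)ᶜ a b :=
    hcomp.map id (fun u hu z _ h => Or.inr (hlift u hu z h))
      fun u hu => (notMem_of_below hu ht).2 i hx1
  have hxy : ReachIn (H.cliqueGraphExcept i) (S.hit i)ᶜ x y :=
    (ReachIn.head (hx2 i hx1) (hlift a ha.right_mem x hax).symm hab).tail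
      (hlift b hb.right_mem y hby) (hy2 i hx1)
  by_cases hcol : H.color y = i
  · exact S.hit_sep x y hcol.symm hne hxy
  · exact hxg (Or.inr ⟨hx1, y, hy1, hcol, hxy⟩)

/-- The dichotomy of `boundary_unique`, with a single edge as the connection. It makes the guards
vertex covers. -/
theorem cover_of_adj (hadj : H.graph.Adj x y) (htx : t ∈ S.nodes x) (hty : t ∈ S.nodes y) :
    x ∈ S.hits t ∪ S.special t ∨ y ∈ S.hits t ∪ S.special t := by
  by_contra! hcon
  obtain ⟨hx1, hx2⟩ := color_mem_of_notMem_hits htx fun h => hcon.1 (Or.inl h)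
  obtain ⟨hy1, hy2⟩ := color_mem_of_notMem_hits hty fun h => hcon.2 (Or.inl h)
  have hxy : ReachIn (H.cliqueGraphExcept (H.color x)) (S.hit (H.color x))ᶜ x y :=
    (ReachIn.refl (hx2 _ hx1)).tail ⟨hadj.ne, Or.inl hadj⟩ (hy2 _ hx1)
  by_cases hcol : H.color y = H.color x
  · exact S.hit_sep x y hcol.symm hadj.ne hxy
  · exact hcon.1 (Or.inr ⟨hx1, y, hy1, hcol, hxy⟩)

/-- A special vertex is determined by its color and the color it reaches: two with the same pair
would be joined through the clique of the second color, outside the hitting set of the first. -/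
theorem ncard_special_le {c : ℕ} (hc : (S.cols t).encard ≤ c) : (S.special t).ncard ≤ c * c := by
  have := H.finite_V
  have hfin : (S.cols t).Finite := Set.finite_of_encard_le_coe hc
  have hcard := (Set.encard_le_coe_iff_finite_ncard_le.1 hc).2
  have hex : ∀ x ∈ S.special t, ∃ y, H.color y ∈ S.cols t ∧ H.color y ≠ H.color x ∧
      ReachIn (H.cliqueGraphExcept (H.color x)) (S.hit (H.color x))ᶜ x y := fun x hx => hx.2
  choose! z hz1 hz2 hz3 using hex
  have h1 : (S.special t).ncard ≤ (S.cols t ×ˢ S.cols t).ncard := by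
    refine Set.ncard_le_ncard_of_injOn (fun x => (H.color x, H.color (z x)))
      (fun x hx => ⟨hx.1, hz1 x hx⟩) ?_ (hfin.prod hfin)
    intro x hx x' hx' heq
    obtain ⟨h1, h2⟩ := Prod.mk.inj heq
    by_contra hne
    have h3 := hz3 x' hx'
    rw [← h1] at h3
    refine S.hit_sep x x' h1 hne (((hz3 x hx).trans ?_).trans h3.symm)
    exact reachIn_of_color_eq (hz3 x hx).right_mem h3.right_mem h2 (hz2 x hx)
  rw [Set.ncard_prod] at h1
  exact h1.trans (Nat.mul_le_mul hcard hcard)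

variable (S) in
/-- The nodes of the decomposition below its root: a node `t`, and a component of the part of the
graph below `t`. -/
abbrev Piece : Type (max u w) :=
  {p : N × Set H.V // ∃ v ∈ S.below p.1, p.2 = S.comp p.1 v}

variable (S) in
/-- The piece at `t` with the component of `v`. -/
def piece (t : N) (v : H.V) (h : v ∈ S.below t) : S.Piece := ⟨(t, S.comp t v), v, h, rfl⟩

open Classical in
variable (S) in
/-- The tree of pieces, below a new root. -/
noncomputable def pieceTree : ParentTree (Option S.Piece) where
  root := none
  parent o := o.elim none fun p =>
    if h : p.1.1 = S.R.root then none
    else some (S.piece (S.R.parent p.1.1) p.2.choose (below_subset_parent h p.2.choose_spec.1))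
  depth o := o.elim 0 fun p => S.R.depth p.1.1 + 1
  depth_root := rfl
  depth_eq := by
    rintro (_ | p) h
    · exact absurd rfl h
    · by_cases hp : p.1.1 = S.R.root
      · simp [hp, S.R.depth_root]
      · simp [hp, piece, S.R.depth_eq _ hp]

theorem piece_eq {h : v ∈ S.below t} {h' : w ∈ S.below t} (hw : w ∈ S.comp t v) :
    S.piece t w h' = S.piece t v h := by
  simp only [piece, comp_eq hw]

theorem exists_eq_piece (p : S.Piece) : ∃ t v, ∃ h : v ∈ S.below t, p = S.piece t v h := by
  obtain ⟨⟨t, K⟩, v, hv, hK⟩ := p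
  exact ⟨t, v, hv, Subtype.ext (Prod.ext rfl hK)⟩

/-- The parent in `pieceTree` is defined by a chosen vertex of the component; any other vertex of it
gives the same parent. -/
theorem parent_piece (h : v ∈ S.below t) (ht : t ≠ S.R.root) :
    S.pieceTree.parent (some (S.piece t v h)) =
      some (S.piece (S.R.parent t) v (below_subset_parent ht h)) := by
  have hch := (S.piece t v h).2.choose_spec
  set w := (S.piece t v h).2.choose
  have hw : w ∈ S.comp t v := by
    have h1 : S.comp t v = S.comp t w := hch.2
    rw [h1]
    exact mem_comp_self hch.1
  have h2 : S.pieceTree.parent (some (S.piece t v h)) =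
      some (S.piece (S.R.parent t) w (below_subset_parent ht hch.1)) := dif_neg ht
  rw [h2]
  exact congrArg some (piece_eq (comp_subset_parent ht hw))

theorem parent_piece_root (h : v ∈ S.below S.R.root) :
    S.pieceTree.parent (some (S.piece S.R.root v h)) = none := dif_pos rfl

variable (S) in
/-- The bag of a node: its part of the component and the boundary of the component. -/
def bag (o : Option S.Piece) : Set H.V :=
  o.elim ∅ fun p => {x | p.1.1 ∈ S.nodes x ∧ x ∈ p.1.2} ∪ S.boundary p.1.1 p.1.2

variable (S) in
/-- The guard of a node. -/
def guard (o : Option S.Piece) : Set H.V :=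
  o.elim ∅ fun p => ((S.hits p.1.1 ∪ S.special p.1.1) ∩ {x | p.1.1 ∈ S.nodes x ∧ x ∈ p.1.2}) ∪
    S.boundary p.1.1 p.1.2

/-- The boundary of a piece is contained in the bag of the parent. -/
theorem boundary_subset_bag (h : v ∈ S.below t) (ht : t ≠ S.R.root)
    (hx : x ∈ S.boundary t (S.comp t v)) :
    x ∈ S.bag (some (S.piece (S.R.parent t) v (below_subset_parent ht h))) := by
  obtain ⟨-, hp⟩ := boundary_spec comp_subset_below hx
  obtain ⟨-, w, hw, hadj⟩ := hx
  by_cases hxb : x ∈ S.below (S.R.parent t)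
  · exact Or.inl ⟨hp, ReachIn.tail (comp_subset_parent ht hw) hadj hxb⟩
  · exact Or.inr ⟨hxb, w, comp_subset_parent ht hw, hadj⟩

/-- Together with `boundary_subset_bag`, this identifies the separator of a piece with its boundary.
-/
theorem mem_boundary_of_mem_bag_parent (h : v ∈ S.below t) (ht : t ≠ S.R.root)
    (hx : x ∈ S.bag (some (S.piece t v h)))
    (hx' : x ∈ S.bag (some (S.piece (S.R.parent t) v (below_subset_parent ht h)))) :
    x ∈ S.boundary t (S.comp t v) := by
  rcases hx with ⟨-, hx2⟩ | hx
  · have hxb := comp_subset_below hx2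
    rcases hx' with ⟨h1, -⟩ | h1
    · exact absurd h1 (not_mem_nodes_parent hxb ht)
    · exact absurd (below_subset_parent ht hxb) h1.1
  · exact hx

/-- Only in the piece at `S.top x` does `x` belong to the bag as a vertex of the component. In every
other bag it is a boundary vertex, and so also lies in the bag of the parent. -/
theorem bag_subtree (x : H.V) : ∃ τ, S.pieceTree.IsSubtree {o | x ∈ S.bag o} τ := by
  have hx : x ∈ S.below (S.top x) := .refl
  refine ⟨some (S.piece (S.top x) x hx), Or.inl ⟨(S.top_spec x).1, mem_comp_self hx⟩, ?_⟩
  rintro (_ | p) hxp hne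
  · exact absurd hxp (Set.notMem_empty x)
  obtain ⟨t, v, hv, rfl⟩ := exists_eq_piece p
  refine ⟨Option.some_ne_none _, ?_⟩
  rcases hxp with ⟨h1, h2⟩ | h1
  · have h3 := eq_top_of_mem (comp_subset_below h2) h1
    change t ∈ S.nodes x at h1
    change x ∈ S.comp t v at h2
    change t = S.top x at h3
    subst h3
    exact absurd (congrArg some (piece_eq h2).symm) hne
  · have ht := (boundary_spec comp_subset_below h1).1
    have h2 := boundary_subset_bag hv ht h1
    rw [← parent_piece hv ht] at h2
    exact h2

theorem bag_edge (h : H.cliqueGraph.Adj x y) : ∃ o, x ∈ S.bag o ∧ y ∈ S.bag o := by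
  -- The piece of the endpoint with the deeper top contains the other endpoint, in its component or
  -- in its boundary.
  have key : ∀ {x y}, H.cliqueGraph.Adj x y → S.R.depth (S.top x) ≤ S.R.depth (S.top y) →
      ∃ o, x ∈ S.bag o ∧ y ∈ S.bag o := by
    intro x y h hd
    have hy : y ∈ S.below (S.top y) := .refl
    obtain ⟨s, hs, hs'⟩ := exists_common_node (S := S) h
    have h1 := (S.top_spec x).mem_of_anc hs ((S.top_spec y).anc hs') hd
    refine ⟨some (S.piece (S.top y) y hy), ?_, Or.inl ⟨(S.top_spec y).1, mem_comp_self hy⟩⟩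
    by_cases hx : x ∈ S.below (S.top y)
    · exact Or.inl ⟨h1, (ReachIn.refl hy).tail h.symm hx⟩
    · exact Or.inr ⟨hx, y, mem_comp_self hy, h.symm⟩
  rcases le_total (S.R.depth (S.top x)) (S.R.depth (S.top y)) with hd | hd
  · exact key h hd
  · obtain ⟨o, h1, h2⟩ := key h.symm hd
    exact ⟨o, h2, h1⟩

/-- The number of vertices that are hit or special at a node with at most `c` colors. -/
theorem ncard_hits_union_special_le {c m : ℕ} (hc : (S.cols t).encard ≤ c)
    (hm : ∀ i, (S.hit i).ncard ≤ m) :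
    (S.hits t).ncard ≤ c * m ∧ (S.hits t ∪ S.special t).ncard ≤ c * m + c * c := by
  have := H.finite_V
  have h1 : (S.hits t).ncard ≤ c * m := by
    refine (ncard_biUnion_le_mul (Set.finite_of_encard_le_coe hc) S.hit fun i _ => hm i).trans ?_
    exact Nat.mul_le_mul_right m (Set.encard_le_coe_iff_finite_ncard_le.1 hc).2
  exact ⟨h1, (Set.ncard_union_le _ _).trans (add_le_add h1 (ncard_special_le hc))⟩

/-- All boundary vertices but at most one are hit or special at the parent of `t`, by
`boundary_unique`. -/
theorem ncard_boundary_le {c m : ℕ} (hc : ∀ t, (S.cols t).encard ≤ c)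
    (hm : ∀ i, (S.hit i).ncard ≤ m) :
    (S.boundary t (S.comp t v)).ncard ≤ c * m + c * c + 1 := by
  have := H.finite_V
  set g := S.hits (S.R.parent t) ∪ S.special (S.R.parent t)
  have h1 : S.boundary t (S.comp t v) ⊆ g ∪ (S.boundary t (S.comp t v) \ g) := by
    intro x hx
    by_cases h : x ∈ g
    · exact Or.inl h
    · exact Or.inr ⟨hx, h⟩
  refine (Set.ncard_le_ncard h1 (Set.toFinite _)).trans ((Set.ncard_union_le _ _).trans ?_)
  refine add_le_add (ncard_hits_union_special_le (hc _) hm).2 ?_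
  rw [Set.ncard_le_one (Set.toFinite _)]
  exact fun x hx y hy => boundary_unique hx.1 hy.1 hx.2 hy.2

theorem encard_le_of_ncard_le {α : Type*} {s : Set α} (hs : s.Finite) {k : ℕ}
    (h : s.ncard ≤ k) : s.encard ≤ k := Set.encard_le_coe_iff_finite_ncard_le.2 ⟨hs, h⟩

/-- The decomposition into pieces is a guarded cutvertex decomposition. -/
theorem exists_guarded [Finite N] (S : H.HittingSystem N) {c m : ℕ}
    (hc : ∀ t, (S.cols t).encard ≤ c) (hm : ∀ i, (S.hit i).ncard ≤ m) :
    ∃ D : H.GuardedCutvertexDecomposition, D.GuardSizeAtMost (2 * (c * m + c * c) + c + 1) ∧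
      D.BagColorsAtMost (2 * (c * m + c * c) + c + 1) := by
  have := H.finite_V
  -- Pieces at the root of `S.R` hang on the extra root, whose bag is empty, so sharing a vertex
  -- with the parent bag excludes them.
  have hroot : ∀ {t v} (h : v ∈ S.below t) {x : H.V},
      x ∈ S.bag (S.pieceTree.parent (some (S.piece t v h))) → t ≠ S.R.root := by
    rintro t v h x hx rfl
    rw [parent_piece_root] at hx
    exact hx
  refine exists_guarded_of_rooted S.pieceTree S.bag S.guard bag_subtree (fun _ _ => bag_edge)
    ?_ ?_ ?_ ?_ ?_ ?_
  · rintro (_ | p) hne x hx hx'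
    · exact hx
    · obtain ⟨t, v, hv, rfl⟩ := exists_eq_piece p
      have ht := hroot hv hx'
      rw [parent_piece hv ht] at hx'
      exact Or.inr (mem_boundary_of_mem_bag_parent hv ht hx hx')
  · rintro (_ | p) x hx
    · exact hx
    · exact hx.imp (fun h => h.2) id
  · rintro (_ | p) x y hx hy hadj
    · exact Or.inl hx
    · rcases hx with hx | hx
      · rcases hy with hy | hy
        · exact (cover_of_adj hadj hx.1 hy.1).imp (fun h => Or.inl ⟨h, hx⟩)
            fun h => Or.inl ⟨h, hy⟩
        · exact Or.inr (Or.inr hy)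
      · exact Or.inl (Or.inr hx)
  · rintro (_ | p) hne x y hx hx' hxg hy hy' hyg
    · exact absurd rfl hne
    · obtain ⟨t, v, hv, rfl⟩ := exists_eq_piece p
      have ht := hroot hv hx'
      rw [parent_piece hv ht] at hx' hxg hy' hyg
      have key : ∀ z, z ∈ S.bag (some (S.piece (S.R.parent t) v (below_subset_parent ht hv))) →
          z ∉ S.guard (some (S.piece (S.R.parent t) v (below_subset_parent ht hv))) →
          z ∉ S.hits (S.R.parent t) ∪ S.special (S.R.parent t) := by
        rintro z (hz | hz) hzg hz'
        · exact hzg (Or.inl ⟨hz', hz⟩)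
        · exact hzg (Or.inr hz)
      exact boundary_unique (mem_boundary_of_mem_bag_parent hv ht hx hx')
        (mem_boundary_of_mem_bag_parent hv ht hy hy') (key x hx' hxg) (key y hy' hyg)
  · rintro (_ | p)
    · simp [guard]
    · obtain ⟨t, v, hv, rfl⟩ := exists_eq_piece p
      refine encard_le_of_ncard_le (Set.toFinite _) ?_
      refine (Set.ncard_union_le _ _).trans ?_
      have h1 := (Set.ncard_le_ncard (Set.inter_subset_left (s := S.hits t ∪ S.special t)
        (t := {x | t ∈ S.nodes x ∧ x ∈ S.comp t v})) (Set.toFinite _)).trans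
        (ncard_hits_union_special_le (hc t) hm).2
      have h2 := ncard_boundary_le (S := S) (t := t) (v := v) hc hm
      exact (add_le_add h1 h2).trans (by omega)
  · rintro (_ | p)
    · simp [bag]
    · obtain ⟨t, v, hv, rfl⟩ := exists_eq_piece p
      -- A vertex of the bag that is neither hit nor in the boundary has one of the at most `c`
      -- colors of `t`. The color count is at most `c + c * m + (c * m + c * c + 1)`.
      have hsub : H.color '' S.bag (some (S.piece t v hv)) ⊆
          S.cols t ∪ H.color '' (S.hits t ∪ S.boundary t (S.comp t v)) := by
        rintro _ ⟨x, hx | hx, rfl⟩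
        · by_cases hxh : x ∈ S.hits t
          · exact Or.inr ⟨x, Or.inl hxh, rfl⟩
          · exact Or.inl (color_mem_of_notMem_hits hx.1 hxh).1
        · exact Or.inr ⟨x, Or.inr hx, rfl⟩
      have h1 := (ncard_hits_union_special_le (hc t) hm).1
      have h2 := ncard_boundary_le (S := S) (t := t) (v := v) hc hm
      have h3 := Set.ncard_union_le (S.hits t) (S.boundary t (S.comp t v))
      have h4 := Set.ncard_image_le (f := H.color)
        (Set.toFinite (S.hits t ∪ S.boundary t (S.comp t v)))
      have h5 := Set.encard_le_coe_iff_finite_ncard_le.1 (hc t)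
      have hfin := h5.1.union (Set.toFinite (H.color '' (S.hits t ∪ S.boundary t (S.comp t v))))
      refine encard_le_of_ncard_le (hfin.subset hsub) ?_
      have h6 := Set.ncard_union_le (S.cols t)
        (H.color '' (S.hits t ∪ S.boundary t (S.comp t v)))
      have h7 := Set.ncard_le_ncard hsub hfin
      have h8 := h5.2
      omega

end HittingSystem

end ColoredGraph

/-! ### The equivalence. -/

theorem mainTheorem5 {C : Type v} (𝓗 : Set (ColoredGraph.{u, v} C)) :
    List.TFAE [
      ∃ c : ℕ, ∀ H ∈ 𝓗, ∀ F ∈ H.spasm, TreewidthAtMost F.graph c,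
      ∃ c : ℕ, ∀ H ∈ 𝓗, TreewidthAtMost H.contraction c ∧ ∀ i : C, ¬ H.HasFlower c i,
      ∃ c : ℕ, ∀ H ∈ 𝓗, ∃ D : H.GuardedCutvertexDecomposition,
        D.GuardSizeAtMost c ∧ D.BagColorsAtMost c] := by
  tfae_have 1 → 2 := by
    rintro ⟨c, hc⟩
    -- The sum serves both conditions, as treewidth bounds can be relaxed and petals can be dropped
    -- from a flower.
    refine ⟨c + ColoredGraph.flowerBound c, fun H hH => ⟨?_, fun i h => ?_⟩⟩
    · exact (ColoredGraph.treewidthAtMost_contraction (hc H hH)).mono (Nat.le_add_right _ _)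
    · refine ColoredGraph.not_hasFlower_of_treewidth (hc H hH) i ?_
      rw [ColoredGraph.hasFlower_iff] at h ⊢
      exact h.mono (Nat.le_add_left _ _)
  tfae_have 2 → 3 := by
    rintro ⟨c, hc⟩
    -- This is the bound of `exists_guarded` with `c + 1` colors per node and hitting sets of size
    -- `nearHittingBound c`.
    refine ⟨2 * ((c + 1) * ColoredGraph.nearHittingBound c + (c + 1) * (c + 1)) + (c + 1) + 1,
      fun H hH => ?_⟩
    obtain ⟨N, _, S, hS, hm⟩ := ColoredGraph.exists_hittingSystem (hc H hH).1 (hc H hH).2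
    exact S.exists_guarded hS hm
  tfae_have 3 → 1 := by
    rintro ⟨c, hc⟩
    refine ⟨c, fun H hH F hF => ?_⟩
    obtain ⟨D, hD, -⟩ := hc H hH
    exact ColoredGraph.treewidthAtMost_of_guarded D hD hF
  tfae_finish
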